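/- Let $\alpha>0$ be irrational with continued fraction expansion $\alpha=[a_0;a_1,a_2,\dots]$ and convergents $p_n/q_n$, and let $n_1<n_2<\cdots$ be positive integers. Write $\{y\}\in[0,1)$ for the fractional part of a real number $y$. Assume that: 1. all $n_k$ are even; 2. $\sum_{k=1}^\infty 2\{q_{n_k}\alpha\}<\min\left(\frac{\alpha}{4},\,1-\frac{\alpha}{4}\right)$; 3. $1+\sum_{k=1}^{\ell}2q_{n_k}<q_{n_\ell+1}$ for all $\ell\ge 1$; 4. $\lim_{\ell\to\infty}a_{n_\ell+1}=\infty$; 5. $a_n=o(\log\log q_n)$ and $a_{n+1}=o(\log\log q_n)$ as $n\to\infty$; 6. $\sum_{k=1}^\infty a_{n_k+1}^{-1}=\infty$; 7. $\sum_{i=1}^{n+1}a_i=O(\log q_n)$ as $n\to\infty$; 8. $\log q_{n_{k-1}+1}=o(\log q_{n_k})$ as $k\to\infty$; 9. $a_{n_k}=2$ and $a_{n_k-1}=2$ for all $k\ge 1$. Let $S^1=\mathbb{R}/\mathbb{Z}$, identified with $[0,1)$, let $R(x)=x+\alpha$ be the rotation of $S^1$ by $\alpha$, and let $$J=\left[0,\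 \sum_{k=1}^\infty 2\{q_{n_k}\alpha\}\right)\subset S^1 .$$ Let $T$ be the rotation by $\alpha$ skewed over the interval $J$, that is, $$T:S^1\times\mathbb{Z}/2\to S^1\times\mathbb{Z}/2,\qquad T(x,j)=\bigl(R(x),\,j+\chi_J(R(x))\bigr),$$ where $\chi_J$ is the characteristic function of $J$. Then $T$ is uniquely ergodic: there is exactly one $T$-invariant Borel probability measure on $S^1\times\mathbb{Z}/2$. -/

import Mathlib

open Filter Asymptotics MeasureTheory
open scoped Topology

noncomputable section

namespace SkewRotation

/-- The `i`-th term `a_i` of the continued fraction expansion of `α`, as a real number (`a_0` is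
the integer part; for irrational `α` the expansion does not terminate, so that the default value
`0` does not occur). -/
def cfTerm (α : ℝ) : ℕ → ℝ
  | 0 => (GenContFract.of α).h
  | i + 1 => ((GenContFract.of α).partDens.get? i).getD 0

/-- The denominator `q_i` of the `i`-th convergent `p_i / q_i` of `α`; `q_0 = 1`, `q_1 = a_1`,
`q_{i+1} = a_{i+1} q_i + q_{i-1}`. -/
def cfDen (α : ℝ) (i : ℕ) : ℝ := (GenContFract.of α).dens i

/-- The standing assumptions on the positive irrational number `α` and on the subsequence
`n_1 < n_2 < ⋯` of the positive integers. The sequence is indexed from `0` here: `n k` is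
`n_{k+1}`. -/
structure Admissible (α : ℝ) (n : ℕ → ℕ) : Prop where
  alpha_pos : 0 < α
  alpha_irrational : Irrational α
  strictMono : StrictMono n
  pos : ∀ k, 0 < n k
  /-- All `n_k` are even. -/
  even : ∀ k, Even (n k)
  /-- `∑ 2{q_{n_k} α}` is finite and less than `min (α/4) (1 - α/4)`. -/
  summable : Summable fun k => 2 * Int.fract (cfDen α (n k) * α)
  tsum_lt : ∑' k, 2 * Int.fract (cfDen α (n k) * α) < min (α / 4) (1 - α / 4)
  /-- `1 + ∑_{k ≤ ℓ} 2 q_{n_k} < q_{n_ℓ + 1}` for all `ℓ`. -/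
  sum_den_lt : ∀ l, 1 + ∑ k ∈ Finset.range (l + 1), 2 * cfDen α (n k) < cfDen α (n l + 1)
  /-- `a_{n_ℓ + 1} → ∞`. -/
  tendsto_term : Tendsto (fun l => cfTerm α (n l + 1)) atTop atTop
  /-- `a_i = o(log log q_i)` and `a_{i+1} = o(log log q_i)`. -/
  term_isLittleO : (fun i => cfTerm α i) =o[atTop] fun i => Real.log (Real.log (cfDen α i))
  term_succ_isLittleO :
    (fun i => cfTerm α (i + 1)) =o[atTop] fun i => Real.log (Real.log (cfDen α i))
  /-- `∑ 1 / a_{n_k + 1} = ∞`. -/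
  sum_inv_term :
    Tendsto (fun N => ∑ k ∈ Finset.range N, (cfTerm α (n k + 1))⁻¹) atTop atTop
  /-- `a_1 + ⋯ + a_{i+1} = O(log q_i)`. -/
  sum_term_isBigO :
    (fun i => ∑ j ∈ Finset.Icc 1 (i + 1), cfTerm α j) =O[atTop] fun i => Real.log (cfDen α i)
  /-- `log q_{n_{k-1} + 1} = o(log q_{n_k})`. -/
  log_den_isLittleO : (fun k => Real.log (cfDen α (n k + 1))) =o[atTop]
    fun k => Real.log (cfDen α (n (k + 1)))
  /-- `a_{n_k} = 2` and `a_{n_k - 1} = 2`. -/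
  term_eq_two : ∀ k, cfTerm α (n k) = 2
  term_pred_eq_two : ∀ k, cfTerm α (n k - 1) = 2

/-- The length `∑ 2{q_{n_k} α}` of the skewing interval. -/
def skewLength (α : ℝ) (n : ℕ → ℕ) : ℝ := ∑' k, 2 * Int.fract (cfDen α (n k) * α)

/-- The rotation `x ↦ x + α` of the circle `ℝ / ℤ`. -/
def rotation (α : ℝ) (x : UnitAddCircle) : UnitAddCircle := x + (α : UnitAddCircle)

/-- The arc of `ℝ / ℤ` that is the image of `[0, s)`. -/
def arc (s : ℝ) : Set UnitAddCircle := (fun t : ℝ => (t : UnitAddCircle)) '' Set.Ico 0 s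

/-- The rotation by `α` skewed over the arc `[0, s)`: `(x, j) ↦ (R x, j + χ_{[0, s)}(R x))`. -/
def skewOver (α s : ℝ) (p : UnitAddCircle × ZMod 2) : UnitAddCircle × ZMod 2 :=
  (rotation α p.1, p.2 + (arc s).indicator (fun _ => (1 : ZMod 2)) (rotation α p.1))

/-- The skew product `T`, i.e. the rotation by `α` skewed over `J = [0, ∑ 2{q_{n_k} α})`. -/
def skewProduct (α : ℝ) (n : ℕ → ℕ) : UnitAddCircle × ZMod 2 → UnitAddCircle × ZMod 2 :=
  skewOver α (skewLength α n)

/-- A transformation of a measurable space is uniquely ergodic if it has exactly one invariant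
probability measure. -/
def UniquelyErgodic {X : Type*} [MeasurableSpace X] (T : X → X) : Prop :=
  ∃! μ : Measure X, IsProbabilityMeasure μ ∧ MeasurePreserving T μ μ

end SkewRotation

end

/-!
The transformation is a `ℤ / 2`-extension of an irrational rotation by the cocycle `χ_J`. As in
Furstenberg's criterion, it is uniquely ergodic as soon as no nonzero function `w` satisfies
`w (x + α) = (-1) ^ χ_J (x + α) * w x`: an invariant measure projects to Lebesgue measure on the
circle, and the density `w` of the difference of its two fibre measures satisfies this equation
(`fibre_density_equivariant`). Such a `w` has constant modulus by ergodicity of the rotation, and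
`w (x + Q α) = ± w x`, the sign being given by the parity of the `Q`-th Birkhoff sum of `χ_J`.
Since translations are continuous in `L¹`, `w` vanishes if there are times `Q` with `Q α → 0` modulo
`1` at which the Birkhoff sum is odd with probability bounded below (`ae_eq_zero_of_return_times`).

To find such times, write `N_k = q_{n_k}` and `δ_k = {N_k α}`, and cut `J` into arcs of length
`2 δ_k`. As `n_k` is even, `δ_k` is `N_k α` modulo `1`, so that modulo `2` the indicator of the
`k`-th arc is a coboundary, whose transfer function `h_k` is the indicator of a tower of `N_k` arcs
of length `δ_k` (`par_two_mul_eq_coboundary`). Take `Q = ∑ N_k` over a block of consecutive indices.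
The function `h_k` is moved by its own return time `N_k` on a set consisting of `2 N_k` disjoint
arcs, of measure `2 N_k δ_k`, which is comparable to `1 / a_{n_k + 1}`. The other return times of
the block, and the arcs beyond the block, only contribute a small error, because the `N_k` grow
quickly (`SparseTimes.size_birkhoff_sub_le`). The sets for different `k` are quasi-independent,
because an orbit segment of length `N_k'` is evenly spread at the scale `δ_k` for `k < k'`
(`integral_visits_mul_visits_le`). As `∑ 1 / a_{n_k + 1}` diverges with terms tending to `0`, the
block can be chosen far out and such that the expected number of these sets that contain a point is
of a prescribed small size; a second moment estimate then shows that this number is odd with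
probability bounded below (`SparseTimes.le_size_sum_level`, `SparseTimes.exists_return_time`).
-/

open Filter Asymptotics MeasureTheory
open scoped Topology

noncomputable section

namespace SkewRotation

/-! ### Continued fractions: arithmetic of the convergents -/

/-- For irrational `α` the expansion does not stop: the `m`-th partial denominator is the integer
part of the inverse of a positive remainder. -/
lemma exists_partDen {α : ℝ} (hα : Irrational α) (m : ℕ) :
    ∃ (ifp ifp' : GenContFract.IntFractPair ℝ),
      GenContFract.IntFractPair.stream α m = some ifp ∧
      GenContFract.IntFractPair.stream α (m + 1) = some ifp' ∧
      0 < ifp.fr ∧ ifp'.b = ⌊ifp.fr⁻¹⌋ ∧ 1 ≤ ifp'.b ∧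
      (GenContFract.of α).s.get? m = some ⟨1, (ifp'.b : ℝ)⟩ := by
  have hnt : ∀ m, GenContFract.IntFractPair.stream α (m + 1) ≠ none := by
    intro m hm
    have h1 := GenContFract.of_terminatedAt_n_iff_succ_nth_intFractPair_stream_eq_none.mpr hm
    obtain ⟨q, hq⟩ := GenContFract.exists_rat_eq_of_terminates (v := α) ⟨m, h1⟩
    exact hα ⟨q, hq.symm⟩
  obtain ⟨ifp', h'⟩ := Option.ne_none_iff_exists'.mp (hnt m)
  obtain ⟨ifp, hs, hfr, rfl⟩ := GenContFract.IntFractPair.succ_nth_stream_eq_some_iff.mp h'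
  refine ⟨ifp, _, hs, h', ?_, rfl, GenContFract.IntFractPair.one_le_succ_nth_stream_b h',
    GenContFract.get?_of_eq_some_of_succ_get?_intFractPair_stream h'⟩
  exact lt_of_le_of_ne (GenContFract.IntFractPair.nth_stream_fr_nonneg hs) (Ne.symm hfr)

/-- Consecutive continuants are integers with determinant `±1`, and the denominators increase. -/
lemma contsAux_eq_intCast {α : ℝ} (hα : Irrational α) (m : ℕ) :
    ∃ pA pB A B : ℤ, (GenContFract.of α).contsAux m = ⟨pA, pB⟩ ∧
      (GenContFract.of α).contsAux (m + 1) = ⟨A, B⟩ ∧ 0 ≤ pB ∧ pB ≤ B ∧ 0 < B ∧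
      IsUnit (A * pB - pA * B) := by
  induction m with
  | zero =>
    refine ⟨1, 0, ⌊α⌋, 1, ?_, ?_, by simp, by simp, by simp, by simp⟩
    · simp [GenContFract.contsAux]
    · simp [GenContFract.contsAux, GenContFract.of_h_eq_floor]
  | succ m ih =>
    obtain ⟨pA, pB, A, B, h1, h2, h3, h4, h5, h6⟩ := ih
    obtain ⟨ifp, ifp', -, -, -, -, hb, hs⟩ := exists_partDen hα m
    refine ⟨A, B, ifp'.b * A + pA, ifp'.b * B + pB, h2, ?_, h5.le, by nlinarith, by nlinarith, ?_⟩
    · rw [GenContFract.contsAux_recurrence hs h1 h2]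
      simp
    · have : (ifp'.b * A + pA) * B - A * (ifp'.b * B + pB) = -(A * pB - pA * B) := by ring
      rw [this]
      exact h6.neg

/-- Arithmetic of a convergent of even index: integrality, coprimality, the recursive growth of
the denominators, and the two-sided bound `1/2 ≤ q_{m+1} (q_m α - p_m) ≤ 1`. -/
lemma convergent_even {α : ℝ} (hα : Irrational α) {m : ℕ} (hm : Even m) :
    ∃ (P : ℤ) (N : ℕ), 0 < N ∧ IsCoprime P (N : ℤ) ∧ cfDen α m = N ∧
      0 < N * α - P ∧ (N * α - P) * cfDen α (m + 1) ≤ 1 ∧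
      1 ≤ 2 * ((N * α - P) * cfDen α (m + 1)) ∧
      1 ≤ cfTerm α (m + 1) ∧
      cfTerm α (m + 1) * N ≤ cfDen α (m + 1) ∧
      cfDen α (m + 1) ≤ (cfTerm α (m + 1) + 1) * N := by
  obtain ⟨pA, pB, A, B, h1, h2, h3, h4, h5, h6⟩ := contsAux_eq_intCast hα m
  obtain ⟨ifp, ifp', hs0, hs1, hfr, hb', hb, hs⟩ := exists_partDen hα m
  have hBN : ((B.toNat : ℕ) : ℤ) = B := Int.toNat_of_nonneg h5.le
  have hBR : ((B.toNat : ℕ) : ℝ) = B := by exact_mod_cast congrArg (Int.cast (R := ℝ)) hBN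
  have hden : cfDen α m = B := by
    show ((GenContFract.of α).contsAux (m + 1)).b = B
    rw [h2]
  have hnum : (GenContFract.of α).nums m = A := by
    show ((GenContFract.of α).contsAux (m + 1)).a = A
    rw [h2]
  have hden' : cfDen α (m + 1) = ifp'.b * B + pB := by
    show ((GenContFract.of α).contsAux (m + 2)).b = _
    rw [GenContFract.contsAux_recurrence hs h1 h2]
    simp
  have hterm : cfTerm α (m + 1) = ifp'.b := by
    simp [cfTerm, GenContFract.partDen_eq_s_b hs]
  have hconv := GenContFract.sub_convs_eq hs0
  simp only [h1, h2, hfr.ne', if_false, hm.neg_one_pow] at hconv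
  have hBpos : (0 : ℝ) < B := by exact_mod_cast h5
  have hpB : (0 : ℝ) ≤ pB := by exact_mod_cast h3
  have hpBB : (pB : ℝ) ≤ B := by exact_mod_cast h4
  have hbR : (1 : ℝ) ≤ ifp'.b := by exact_mod_cast hb
  have hinv1 : (ifp'.b : ℝ) ≤ ifp.fr⁻¹ := by rw [hb']; exact Int.floor_le _
  have hinv2 : ifp.fr⁻¹ < ifp'.b + 1 := by rw [hb']; exact Int.lt_floor_add_one _
  have hE : (0 : ℝ) < ifp.fr⁻¹ * B + pB := by positivity
  have hδ : (B : ℝ) * α - A = 1 / (ifp.fr⁻¹ * B + pB) := by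
    have hc : (GenContFract.of α).convs m = A / B := by
      rw [GenContFract.conv_eq_num_div_den, hnum]
      congr 1
    rw [hc] at hconv
    have : α = A / B + 1 / (B * (ifp.fr⁻¹ * B + pB)) := by linarith
    rw [this]
    field_simp
    ring
  refine ⟨A, B.toNat, by omega, ?_, by rw [hBR, hden], ?_, ?_, ?_,
    by rw [hterm]; exact hbR, ?_, ?_⟩
  · rw [hBN]
    rcases Int.isUnit_iff.mp h6 with h | h
    · exact ⟨pB, -pA, by linarith⟩
    · exact ⟨-pB, pA, by linarith⟩
  · rw [hBR, hδ]; positivity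
  · rw [hBR, hδ, hden', div_mul_eq_mul_div, one_mul, div_le_one hE]
    nlinarith
  · rw [hBR, hδ, hden', div_mul_eq_mul_div, one_mul, ← mul_div_assoc, one_le_div hE]
    nlinarith
  · rw [hBR, hterm, hden']; linarith
  · rw [hBR, hterm, hden']; linarith

/-! ### The sparse sequence of denominators -/

/-- The signed distance `N_k α - P_k` of `N_k α` from the integer `P_k`. -/
def gap (α : ℝ) (N : ℕ → ℕ) (P : ℕ → ℤ) (k : ℕ) : ℝ := N k * α - P k

/-- The arithmetic properties of the denominators `N_k = q_{n_k}` and numerators `P_k = p_{n_k}`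
on which non-triviality of the skewing cocycle rests. -/
structure SparseTimes (α : ℝ) (N : ℕ → ℕ) (P : ℕ → ℤ) : Prop where
  pos : ∀ k, 0 < N k
  coprime : ∀ k, IsCoprime (P k) (N k : ℤ)
  gap_pos : ∀ k, 0 < gap α N P k
  summable : Summable (gap α N P)
  tsum_lt : ∑' k, 2 * gap α N P k < 1
  tendsto_mul_gap : Tendsto (fun k => N k * gap α N P k) atTop (𝓝 0)
  tendsto_sum : Tendsto (fun l => ∑ k ∈ Finset.range l, N k * gap α N P k) atTop atTop
  one_le_succ_mul_gap : ∀ k, 1 ≤ 2 * (N (k + 1) * gap α N P k)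
  tendsto_sum_div : Tendsto (fun k => (∑ j ∈ Finset.range k, (N j : ℝ)) / N k) atTop (𝓝 0)

lemma cfDen_mono (α : ℝ) : Monotone (cfDen α) :=
  monotone_nat_of_le_succ fun _ => GenContFract.of_den_mono

/-- Passage to the sequence `N_k = q_{n_k}`. Here `N_k δ_k` lies between `1 / (4 a_{n_k + 1})` and
`1 / a_{n_k + 1}`, which gives both its convergence to `0` and the divergence of its sum. -/
lemma Admissible.exists_sparseTimes {α : ℝ} {n : ℕ → ℕ} (h : Admissible α n) :
    ∃ N P, SparseTimes α N P ∧ skewLength α n = ∑' k, 2 * gap α N P k := by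
  choose P N hN hcop hden hpos hle hge hterm hlo hhi using
    fun k => convergent_even h.alpha_irrational (h.even k)
  have hsum : ∀ l, 1 + 2 * ∑ k ∈ Finset.range (l + 1), (N k : ℝ) < cfDen α (n l + 1) := by
    intro l
    have := h.sum_den_lt l
    simp only [hden, ← Finset.mul_sum] at this
    exact this
  have hr1 : ∀ k, 1 < cfDen α (n k + 1) := by
    intro k
    have := hsum k
    have h0 : 0 ≤ ∑ k ∈ Finset.range (k + 1), (N k : ℝ) := by positivity
    linarith
  have hgap : ∀ k, 0 < gap α N P k := hpos
  have hgap1 : ∀ k, gap α N P k < 1 := by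
    intro k
    have h1 : gap α N P k * cfDen α (n k + 1) ≤ 1 := hle k
    have h2 := hgap k
    have h3 := hr1 k
    nlinarith
  have hfract : ∀ k, Int.fract (cfDen α (n k) * α) = gap α N P k := by
    intro k
    rw [hden, Int.fract_eq_iff]
    exact ⟨(hgap k).le, hgap1 k, P k, by simp [gap]⟩
  have hr_succ : ∀ k, cfDen α (n k + 1) ≤ N (k + 1) := by
    intro k
    rw [← hden]
    exact cfDen_mono α (h.strictMono (Nat.lt_succ_self k))
  have hprod_le : ∀ k, N k * gap α N P k ≤ (cfTerm α (n k + 1))⁻¹ := by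
    intro k
    have h1 : gap α N P k * cfDen α (n k + 1) ≤ 1 := hle k
    have h2 := hgap k
    have h3 := hterm k
    have h4 := hlo k
    rw [← one_div, le_div_iff₀ (by linarith)]
    nlinarith
  have hprod_ge : ∀ k, (1 / 4) * (cfTerm α (n k + 1))⁻¹ ≤ N k * gap α N P k := by
    intro k
    have h1 : 1 ≤ 2 * (gap α N P k * cfDen α (n k + 1)) := hge k
    have h2 := hgap k
    have h3 := hterm k
    have h4 := hhi k
    have h5 : (0 : ℝ) < N k := by exact_mod_cast hN k
    rw [← div_eq_mul_inv, div_le_iff₀ (by linarith)]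
    have h6 : gap α N P k * cfDen α (n k + 1) ≤
        gap α N P k * ((cfTerm α (n k + 1) + 1) * N k) := by gcongr
    have h7 : 0 < gap α N P k * N k := by positivity
    nlinarith
  have hNlarge : ∀ k : ℕ, (k : ℝ) ≤ N k := by
    intro k
    cases k with
    | zero => simp
    | succ k =>
      have h1 := hr_succ k
      have h2 := hsum k
      have h3 : ((k + 1 : ℕ) : ℝ) ≤ ∑ j ∈ Finset.range (k + 1), (N j : ℝ) := by
        have : ∑ j ∈ Finset.range (k + 1), (1 : ℝ) ≤ ∑ j ∈ Finset.range (k + 1), (N j : ℝ) :=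
          Finset.sum_le_sum fun j _ => by exact_mod_cast hN j
        simpa using this
      have h4 : (0 : ℝ) ≤ ((k + 1 : ℕ) : ℝ) := by positivity
      linarith
  have hNtop : Tendsto (fun k => (N k : ℝ)) atTop atTop :=
    tendsto_atTop_mono hNlarge tendsto_natCast_atTop_atTop
  have htwo : Summable fun k => 2 * gap α N P k := by
    simpa only [hfract] using h.summable
  have hlen : skewLength α n = ∑' k, 2 * gap α N P k := by simp only [skewLength, hfract]
  refine ⟨N, P, ⟨hN, hcop, hgap, (summable_mul_left_iff two_ne_zero).mp htwo, ?_, ?_, ?_, ?_, ?_⟩,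
    hlen⟩
  · rw [← hlen]
    have h1 := h.tsum_lt
    change skewLength α n < _ at h1
    have h2 := min_le_left (α / 4) (1 - α / 4)
    have h3 := min_le_right (α / 4) (1 - α / 4)
    linarith
  · refine squeeze_zero (fun k => mul_nonneg (Nat.cast_nonneg _) (hgap k).le) hprod_le ?_
    exact tendsto_inv_atTop_zero.comp h.tendsto_term
  · refine tendsto_atTop_mono (fun l => ?_)
      (h.sum_inv_term.const_mul_atTop (by norm_num : (0:ℝ) < 1 / 4))
    rw [Finset.mul_sum]
    exact Finset.sum_le_sum fun k _ => hprod_ge k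
  · intro k
    have h1 : 1 ≤ 2 * (gap α N P k * cfDen α (n k + 1)) := hge k
    have h2 := hr_succ k
    have h3 := hgap k
    nlinarith
  · -- the sum up to `N_k` is at most `q_{n_k + 1}`, which is eventually at most `√N_{k + 1}`
    rw [← tendsto_add_atTop_iff_nat 1]
    have hsqrt : Tendsto (fun k => (Real.sqrt (N (k + 1)))⁻¹) atTop (𝓝 0) :=
      (tendsto_inv_atTop_zero.comp Real.tendsto_sqrt_atTop).comp
        (hNtop.comp (tendsto_add_atTop_nat 1))
    refine squeeze_zero' (Eventually.of_forall fun k => by positivity) ?_ hsqrt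
    filter_upwards [h.log_den_isLittleO.bound (by norm_num : (0:ℝ) < 1 / 2)] with k hk
    have h1 := hsum k
    have h2 := hr1 k
    have h3 := hr_succ k
    have hNk : (1 : ℝ) < N (k + 1) := h2.trans_le h3
    rw [hden, Real.norm_of_nonneg (Real.log_nonneg h2.le),
      Real.norm_of_nonneg (Real.log_nonneg hNk.le)] at hk
    have h4 : cfDen α (n k + 1) ≤ Real.sqrt (N (k + 1)) := by
      rw [← Real.log_le_log_iff (by linarith) (Real.sqrt_pos.mpr (by linarith)),
        Real.log_sqrt (by linarith)]
      linarith
    have h5 : 0 < Real.sqrt (N (k + 1)) := by linarith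
    have h6 : Real.sqrt (N (k + 1)) * Real.sqrt (N (k + 1)) = N (k + 1) :=
      Real.mul_self_sqrt (by linarith)
    have h7 : (0 : ℝ) ≤ ∑ j ∈ Finset.range (k + 1), (N j : ℝ) := by positivity
    rw [div_le_iff₀ (by linarith)]
    calc _ ≤ Real.sqrt (N (k + 1)) := by linarith
      _ = _ := by rw [eq_inv_mul_iff_mul_eq₀ h5.ne', h6]

/-! ### Arcs of the circle -/

lemma coe_mem_arc {d : ℝ} (hd : d ≤ 1) (t : ℝ) :
    (t : UnitAddCircle) ∈ arc d ↔ Int.fract t < d := by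
  constructor
  · rintro ⟨u, ⟨hu0, hud⟩, hut⟩
    obtain ⟨z, hz⟩ := AddCircle.coe_eq_zero_iff (1 : ℝ) |>.mp
      (show ((t - u : ℝ) : AddCircle (1 : ℝ)) = 0 by
        rw [AddCircle.coe_sub]; exact sub_eq_zero.mpr hut.symm)
    have h1 : t = u + z := by simp at hz; linarith
    rw [h1, Int.fract_add_intCast, Int.fract_eq_self.mpr ⟨hu0, hud.trans_le hd⟩]
    exact hud
  · intro h
    refine ⟨Int.fract t, ⟨Int.fract_nonneg t, h⟩, ?_⟩
    show ((Int.fract t : ℝ) : AddCircle (1 : ℝ)) = t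
    rw [← sub_eq_zero, ← AddCircle.coe_sub, AddCircle.coe_eq_zero_iff]
    exact ⟨-⌊t⌋, by rw [← Int.self_sub_floor]; simp⟩

lemma measurableSet_arc {d : ℝ} (hd : d ≤ 1) : MeasurableSet (arc d) := by
  have : arc d =
      {x | ((AddCircle.measurableEquivIco (1 : ℝ) 0 x : Set.Ico (0:ℝ) (0 + 1)) : ℝ) < d} := by
    ext x
    have hx : (((AddCircle.measurableEquivIco (1 : ℝ) 0 x : Set.Ico (0:ℝ) (0 + 1)) : ℝ) :
        UnitAddCircle) = x :=
      (AddCircle.measurableEquivIco (1 : ℝ) 0).symm_apply_apply x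
    have hI := (AddCircle.measurableEquivIco (1 : ℝ) 0 x).2
    conv_lhs => rw [← hx]
    rw [coe_mem_arc hd, Int.fract_eq_self.mpr ⟨hI.1, hI.2.trans_eq (zero_add 1)⟩]
    rfl
  rw [this]
  exact measurableSet_lt (measurable_subtype_coe.comp (MeasurableEquiv.measurable _))
    measurable_const

lemma volume_real_arc {d : ℝ} (hd0 : 0 ≤ d) (hd : d ≤ 1) : volume.real (arc d) = d := by
  have hmp := UnitAddCircle.measurePreserving_mk 0
  have h1 := hmp.measureReal_preimage (measurableSet_arc hd).nullMeasurableSet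
  rw [← h1, measureReal_restrict_apply' measurableSet_Ioc]
  have : ((fun t : ℝ => (t : UnitAddCircle)) ⁻¹' arc d ∩ Set.Ioc 0 (0 + 1) : Set ℝ)
      =ᵐ[volume] Set.Ico 0 d := by
    have h0 : ∀ᵐ t : ℝ, t ≠ 0 := by simp [ae_iff]
    have h1 : ∀ᵐ t : ℝ, t ≠ 1 := by simp [ae_iff]
    filter_upwards [h0, h1] with t ht0 ht1
    apply propext
    show ((t : UnitAddCircle) ∈ arc d ∧ t ∈ Set.Ioc (0:ℝ) (0 + 1)) ↔ t ∈ Set.Ico 0 d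
    rw [coe_mem_arc hd, Set.mem_Ioc, Set.mem_Ico]
    constructor
    · rintro ⟨h2, h3, h4⟩
      have : t < 1 := lt_of_le_of_ne (by linarith) ht1
      rw [Int.fract_eq_self.mpr ⟨h3.le, this⟩] at h2
      exact ⟨h3.le, h2⟩
    · rintro ⟨h2, h3⟩
      rw [Int.fract_eq_self.mpr ⟨h2, by linarith⟩]
      exact ⟨h3, lt_of_le_of_ne h2 (Ne.symm ht0), by linarith⟩
  rw [measureReal_congr this]
  simp [measureReal_def, hd0]

/-- The indicator of the arc `[0, d)` with values in `ℕ`, so that visits can be counted as well as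
reduced modulo `2`. -/
def hit (d : ℝ) (x : UnitAddCircle) : ℕ := (arc d).indicator 1 x

lemma hit_coe {d : ℝ} (hd : d ≤ 1) (t : ℝ) : hit d t = if Int.fract t < d then 1 else 0 := by
  classical
  simp only [hit, Set.indicator_apply, coe_mem_arc hd, Pi.one_apply]

lemma hit_le_one (d : ℝ) (x : UnitAddCircle) : hit d x ≤ 1 := by
  classical
  simp only [hit, Set.indicator_apply, Pi.one_apply]; split_ifs <;> simp

lemma measurable_hit {d : ℝ} (hd : d ≤ 1) : Measurable (hit d) :=
  measurable_one.indicator (measurableSet_arc hd)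

lemma hit_add {d e : ℝ} (hd : 0 ≤ d) (he : 0 ≤ e) (hde : d + e ≤ 1) (x : UnitAddCircle) :
    hit (d + e) x = hit d x + hit e (x - d) := by
  obtain ⟨t, ⟨ht0, ht1⟩, rfl⟩ : ∃ t : ℝ, t ∈ Set.Ico (0 : ℝ) 1 ∧ (t : UnitAddCircle) = x := by
    have hI := (AddCircle.equivIco (1 : ℝ) 0 x).2
    exact ⟨_, ⟨hI.1, hI.2.trans_eq (zero_add 1)⟩, (AddCircle.equivIco (1 : ℝ) 0).symm_apply_apply x⟩
  have : ((t : UnitAddCircle) - (d : UnitAddCircle)) = ((t - d : ℝ) : UnitAddCircle) := rfl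
  rw [this, hit_coe hde, hit_coe (by linarith), hit_coe (by linarith),
    Int.fract_eq_self.mpr ⟨ht0, ht1⟩]
  by_cases htd : t < d
  · have h1 : Int.fract (t - d) = t - d + 1 := by
      rw [Int.fract_eq_iff]
      exact ⟨by linarith, by linarith, -1, by simp⟩
    rw [h1, if_pos (by linarith), if_pos htd, if_neg (by linarith)]
  · have h1 : Int.fract (t - d) = t - d := Int.fract_eq_self.mpr ⟨by linarith, by linarith⟩
    rw [h1, if_neg htd]
    by_cases h : t < d + e
    · rw [if_pos h, if_pos (by linarith)]
    · rw [if_neg h, if_neg (by linarith)]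

/-- The indicator of the arc `[0, d)` with values in `ℤ / 2`. -/
def par (d : ℝ) (x : UnitAddCircle) : ZMod 2 := hit d x

lemma par_eq_indicator (d : ℝ) (x : UnitAddCircle) :
    par d x = (arc d).indicator (fun _ => (1 : ZMod 2)) x := by
  classical
  simp only [par, hit, Set.indicator_apply, Pi.one_apply]; split_ifs <;> simp

lemma par_add {d e : ℝ} (hd : 0 ≤ d) (he : 0 ≤ e) (hde : d + e ≤ 1) (x : UnitAddCircle) :
    par (d + e) x = par d x + par e (x - d) := by
  simp [par, hit_add hd he hde]

lemma par_ne_zero_iff {d : ℝ} {x : UnitAddCircle} : par d x ≠ 0 ↔ x ∈ arc d := by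
  rw [par_eq_indicator]; simp

/-- The measure of the set on which a `ℤ / 2`-valued function does not vanish. -/
def size (f : UnitAddCircle → ZMod 2) : ℝ := volume.real {x | f x ≠ 0}

lemma size_zero : size (fun _ => 0) = 0 := by simp [size]

lemma size_add_le (f g : UnitAddCircle → ZMod 2) :
    size (fun x => f x + g x) ≤ size f + size g := by
  refine (measureReal_mono ?_).trans (measureReal_union_le _ _)
  intro x hx
  by_contra h
  simp only [Set.mem_union, Set.mem_ofPred_eq, not_or, not_not] at h
  exact hx (by simp [h.1, h.2])

lemma size_neg (f : UnitAddCircle → ZMod 2) : size (fun x => - f x) = size f := by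
  simp [size]

lemma size_sub_le (f g : UnitAddCircle → ZMod 2) :
    size (fun x => f x - g x) ≤ size f + size g := by
  have := size_add_le f (fun x => - g x)
  rw [size_neg] at this
  simpa only [sub_eq_add_neg] using this

lemma size_sum_le {ι : Type*} (s : Finset ι) (f : ι → UnitAddCircle → ZMod 2) :
    size (fun x => ∑ i ∈ s, f i x) ≤ ∑ i ∈ s, size (f i) := by
  classical
  induction s using Finset.induction_on with
  | empty => simp [size_zero]
  | insert i s hi ih =>
    simp only [Finset.sum_insert hi]
    exact (size_add_le _ _).trans (by gcongr)

lemma size_comp_add (f : UnitAddCircle → ZMod 2) (c : UnitAddCircle) :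
    size (fun x => f (x + c)) = size f := by
  unfold size
  rw [measureReal_def, measureReal_def]
  congr 1
  exact measure_preimage_add_right volume c {x | f x ≠ 0}

lemma size_comp_sub (f : UnitAddCircle → ZMod 2) (c : UnitAddCircle) :
    size (fun x => f (x - c)) = size f := by
  simpa only [sub_eq_add_neg] using size_comp_add f (-c)

lemma size_par {d : ℝ} (hd0 : 0 ≤ d) (hd : d ≤ 1) : size (par d) = d := by
  simp only [size, par_ne_zero_iff]
  exact volume_real_arc hd0 hd

/-- Translating an arc by `t` changes its indicator on a set of measure at most `2 t`. -/
lemma size_par_translate_le {d t : ℝ} (hd : 0 ≤ d) (ht : 0 ≤ t) (hdt : d + t ≤ 1) :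
    size (fun x => par d (x + t) - par d x) ≤ 2 * t := by
  -- both splittings of the arc `[0, d + t)` agree
  have key : ∀ x, par d (x + t - t) - par d (x + t) =
      par t (x + t - d) - par t (x + t) := by
    intro x
    have h1 := par_add hd ht hdt (x + t)
    have h2 := par_add ht hd (by linarith) (x + t)
    rw [add_comm t d] at h2
    rw [h1] at h2
    linear_combination -h2
  have h3 : (fun x : UnitAddCircle => par d (x + t) - par d x) =
      fun x => par t (x + t) - par t (x + (t - d)) := by
    funext x
    have := key x
    rw [add_sub_cancel_right] at this
    rw [← add_sub_assoc]
    linear_combination -this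
  rw [h3]
  refine (size_sub_le (fun x => par t (x + t)) (fun x => par t (x + (t - d)))).trans ?_
  rw [size_comp_add, size_comp_add, size_par ht (by linarith)]
  linarith

/-! ### Transfer functions and the splitting of the Birkhoff sums -/

/-- The parity of the number of `i < N` for which `x` lies in the arc of length `d` that starts at
`σ + i θ`. -/
def tower (θ : UnitAddCircle) (d : ℝ) (N : ℕ) (σ x : UnitAddCircle) : ZMod 2 :=
  ∑ i ∈ Finset.range N, par d (x - σ - i • θ)

lemma tower_sub_tower (θ : UnitAddCircle) (d : ℝ) (N : ℕ) (σ x : UnitAddCircle) :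
    tower θ d N σ x - tower θ d N σ (x - θ) = par d (x - σ) - par d (x - σ - N • θ) := by
  have h := Finset.sum_range_sub' (fun i : ℕ => par d (x - σ - i • θ)) N
  rw [zero_smul, sub_zero] at h
  rw [← h, tower, tower, ← Finset.sum_sub_distrib]
  refine Finset.sum_congr rfl fun i _ => ?_
  congr 2
  rw [add_smul, one_smul]
  abel

/-- If `d` is `N θ` modulo `1`, then the cocycle of an arc of length `2 d` is a coboundary
modulo `2`, with the tower as transfer function. -/
lemma par_two_mul_eq_coboundary {θ : UnitAddCircle} {d : ℝ} {N : ℕ} (hd : 0 ≤ d) (hd1 : 2 * d ≤ 1)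
    (hN : (d : UnitAddCircle) = N • θ) (σ x : UnitAddCircle) :
    par (2 * d) (x - σ) = tower θ d N σ x - tower θ d N σ (x - θ) := by
  rw [tower_sub_tower, two_mul, par_add hd hd (by linarith), hN, CharTwo.sub_eq_add]

/-- Under `P` steps of the rotation the tower changes only near its two ends. -/
lemma size_tower_nsmul_le (θ : UnitAddCircle) {d : ℝ} (hd : 0 ≤ d) (hd1 : d ≤ 1) (N : ℕ)
    (σ : UnitAddCircle) (P : ℕ) :
    size (fun x => tower θ d N σ (x + P • θ) - tower θ d N σ x) ≤ 2 * P * d := by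
  have h1 : (fun x => tower θ d N σ (x + P • θ) - tower θ d N σ x) = fun x =>
      ∑ j ∈ Finset.range P,
        (par d (x + ((j + 1) • θ - σ)) - par d (x + ((j + 1) • θ - σ - N • θ))) := by
    funext x
    have h := Finset.sum_range_sub (fun j : ℕ => tower θ d N σ (x + j • θ)) P
    rw [zero_smul, add_zero] at h
    rw [← h]
    refine Finset.sum_congr rfl fun j _ => ?_
    have h2 := tower_sub_tower θ d N σ (x + (j + 1) • θ)
    have h3 : x + (j + 1) • θ - θ = x + j • θ := by rw [add_smul, one_smul]; abel
    rw [h3] at h2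
    rw [h2, add_sub_assoc, add_sub_assoc]
  rw [h1]
  refine (size_sum_le _ _).trans ?_
  have h4 : ∀ j ∈ Finset.range P, size (fun x =>
      par d (x + ((j + 1) • θ - σ)) - par d (x + ((j + 1) • θ - σ - N • θ))) ≤ 2 * d := by
    intro j _
    refine (size_sub_le (fun x => par d (x + _)) (fun x => par d (x + _))).trans ?_
    rw [size_comp_add, size_comp_add, size_par hd hd1]
    linarith
  refine (Finset.sum_le_sum h4).trans ?_
  simp only [Finset.sum_const, Finset.card_range, nsmul_eq_mul]
  linarith

/-- A translation by `t` moves the tower on a set of measure at most `2 t` for each of its arcs. -/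
lemma size_tower_translate_le (θ : UnitAddCircle) {d t : ℝ} (hd : 0 ≤ d) (ht : 0 ≤ t)
    (hdt : d + t ≤ 1) (N : ℕ) (σ : UnitAddCircle) :
    size (fun x => tower θ d N σ (x + t) - tower θ d N σ x) ≤ 2 * N * t := by
  have h1 : (fun x : UnitAddCircle => tower θ d N σ (x + t) - tower θ d N σ x) = fun x =>
      ∑ i ∈ Finset.range N,
        (fun y : UnitAddCircle => par d (y + t) - par d y) (x - (σ + i • θ)) := by
    funext x
    rw [tower, tower, ← Finset.sum_sub_distrib]
    refine Finset.sum_congr rfl fun i _ => ?_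
    congr 2 <;> abel
  rw [h1]
  refine (size_sum_le _ _).trans ?_
  refine (Finset.sum_le_sum (g := fun _ => 2 * t) fun i _ => ?_).trans ?_
  · exact (size_comp_sub (fun y : UnitAddCircle => par d (y + t) - par d y) _).trans_le
      (size_par_translate_le hd ht hdt)
  · simp only [Finset.sum_const, Finset.card_range, nsmul_eq_mul]
    linarith

/-- The change of the tower under its own `N` steps counts the visits to `2 N` arcs. -/
lemma tower_add_nsmul_sub (θ : UnitAddCircle) (d : ℝ) (N : ℕ) (σ x : UnitAddCircle) :
    tower θ d N σ (x + N • θ) - tower θ d N σ x =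
      ∑ i ∈ Finset.range (2 * N), par d (x + (N • θ - σ) - i • θ) := by
  rw [two_mul, Finset.sum_range_add, CharTwo.sub_eq_add, tower, tower]
  congr 1 <;> refine Finset.sum_congr rfl fun i _ => ?_ <;> congr 1
  · abel
  · rw [add_smul]; abel

section
variable {α : ℝ} {N : ℕ → ℕ} {P : ℕ → ℤ}

lemma coe_gap (α : ℝ) (N : ℕ → ℕ) (P : ℕ → ℤ) (k : ℕ) :
    (gap α N P k : UnitAddCircle) = N k • (α : UnitAddCircle) := by
  have h : ((P k : ℝ) : AddCircle (1 : ℝ)) = 0 := by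
    rw [AddCircle.coe_eq_zero_iff]; exact ⟨P k, by simp⟩
  show ((gap α N P k : ℝ) : AddCircle (1 : ℝ)) = _
  rw [gap, AddCircle.coe_sub, h, sub_zero, ← AddCircle.coe_nsmul, nsmul_eq_mul]

lemma coe_sum_gap (α : ℝ) (N : ℕ → ℕ) (P : ℕ → ℤ) (s : Finset ℕ) :
    ((∑ k ∈ s, gap α N P k : ℝ) : UnitAddCircle) = (∑ k ∈ s, N k) • (α : UnitAddCircle) := by
  classical
  induction s using Finset.induction_on with
  | empty => simp
  | insert i s hi ih =>
    rw [Finset.sum_insert hi, Finset.sum_insert hi, add_smul, ← ih, ← coe_gap α N P]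
    exact AddCircle.coe_add ..

/-- The sum of the lengths of the first `k` arcs, at which the arc of index `k` begins. -/
def partialLength (α : ℝ) (N : ℕ → ℕ) (P : ℕ → ℤ) (k : ℕ) : ℝ :=
  ∑ j ∈ Finset.range k, 2 * gap α N P j

namespace SparseTimes

lemma summable_two_mul (h : SparseTimes α N P) : Summable fun k => 2 * gap α N P k :=
  h.summable.mul_left 2

lemma partialLength_nonneg (h : SparseTimes α N P) (k : ℕ) : 0 ≤ partialLength α N P k :=
  Finset.sum_nonneg fun j _ => by linarith [h.gap_pos j]

lemma partialLength_le (h : SparseTimes α N P) (k : ℕ) :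
    partialLength α N P k ≤ ∑' k, 2 * gap α N P k :=
  h.summable_two_mul.sum_le_tsum _ fun j _ => by linarith [h.gap_pos j]

lemma sum_gap_le (h : SparseTimes α N P) (s : Finset ℕ) : 2 * ∑ k ∈ s, gap α N P k ≤ 1 := by
  rw [Finset.mul_sum]
  exact (h.summable_two_mul.sum_le_tsum s fun j _ => by linarith [h.gap_pos j]).trans h.tsum_lt.le

lemma two_mul_gap_le (h : SparseTimes α N P) (k : ℕ) : 2 * gap α N P k ≤ 1 := by
  simpa using h.sum_gap_le {k}

/-- The transfer function of the `k`-th piece of the skewing arc. -/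
def level (α : ℝ) (N : ℕ → ℕ) (P : ℕ → ℤ) (k : ℕ) : UnitAddCircle → ZMod 2 :=
  tower α (gap α N P k) (N k) (partialLength α N P k)

/-- Cutting off the first `l` pieces of the skewing arc, modulo `2` its indicator is a coboundary
plus the indicator of the remaining arc. -/
lemma par_tsum_eq (h : SparseTimes α N P) (l : ℕ) (x : UnitAddCircle) :
    par (∑' k, 2 * gap α N P k) x =
      ∑ k ∈ Finset.range l, (level α N P k x - level α N P k (x - α)) +
      par (∑' k, 2 * gap α N P k - partialLength α N P l) (x - partialLength α N P l) := by
  induction l with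
  | zero => simp [partialLength]
  | succ l ih =>
    have h1 : partialLength α N P (l + 1) = partialLength α N P l + 2 * gap α N P l :=
      Finset.sum_range_succ _ _
    have h2 := h.partialLength_le (l + 1)
    have h3 := h.partialLength_nonneg l
    have h4 := h.tsum_lt
    have h5 := h.gap_pos l
    have h6 := par_add (d := 2 * gap α N P l)
      (e := ∑' k, 2 * gap α N P k - partialLength α N P (l + 1)) (by linarith) (by linarith)
      (by linarith) (x - partialLength α N P l)
    have h7 : 2 * gap α N P l + (∑' k, 2 * gap α N P k - partialLength α N P (l + 1)) =
        ∑' k, 2 * gap α N P k - partialLength α N P l := by linarith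
    rw [h7, par_two_mul_eq_coboundary h5.le (h.two_mul_gap_le l) (coe_gap α N P l)] at h6
    have h8 : x - (partialLength α N P l : UnitAddCircle) -
        ((2 * gap α N P l : ℝ) : UnitAddCircle) =
        x - (partialLength α N P (l + 1) : UnitAddCircle) := by
      rw [h1, sub_sub]; rfl
    rw [ih, h6, Finset.sum_range_succ, h8, level, add_assoc]

lemma sum_par_tsum_eq (h : SparseTimes α N P) (l Q : ℕ) (x : UnitAddCircle) :
    ∑ i ∈ Finset.range Q, par (∑' k, 2 * gap α N P k) (x + (i + 1) • (α : UnitAddCircle)) =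
      ∑ k ∈ Finset.range l, (level α N P k (x + Q • (α : UnitAddCircle)) - level α N P k x) +
      ∑ i ∈ Finset.range Q, par (∑' k, 2 * gap α N P k - partialLength α N P l)
        (x + ((i + 1) • (α : UnitAddCircle) - partialLength α N P l)) := by
  have h1 : ∀ i, par (∑' k, 2 * gap α N P k) (x + (i + 1) • (α : UnitAddCircle)) =
      ∑ k ∈ Finset.range l, (level α N P k (x + (i + 1) • (α : UnitAddCircle)) -
        level α N P k (x + i • (α : UnitAddCircle))) +
      par (∑' k, 2 * gap α N P k - partialLength α N P l)
        (x + ((i + 1) • (α : UnitAddCircle) - partialLength α N P l)) := by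
    intro i
    rw [h.par_tsum_eq l]
    have h3 : x + (i + 1) • (α : UnitAddCircle) - α = x + i • (α : UnitAddCircle) := by
      rw [add_smul, one_smul]; abel
    rw [h3, add_sub_assoc]
  simp only [h1, Finset.sum_add_distrib]
  rw [Finset.sum_comm]
  congr 1
  refine Finset.sum_congr rfl fun k _ => ?_
  have := Finset.sum_range_sub (fun i : ℕ => level α N P k (x + i • (α : UnitAddCircle))) Q
  rw [zero_smul, add_zero] at this
  exact this

/-- For a block `l ≤ k < l'` of levels and `Q = ∑ N k` over the block, the `Q`-th Birkhoff sum of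
the skewing cocycle is, up to a small set, the sum of the changes that each level of the block
undergoes under its own return time. -/
lemma size_birkhoff_sub_le (h : SparseTimes α N P) (l l' : ℕ) :
    size (fun x =>
      ∑ i ∈ Finset.range (∑ k ∈ Finset.Ico l l', N k),
        par (∑' k, 2 * gap α N P k) (x + (i + 1) • (α : UnitAddCircle)) -
      ∑ k ∈ Finset.Ico l l',
        (level α N P k (x + N k • (α : UnitAddCircle)) - level α N P k x)) ≤
    4 * ∑ k ∈ Finset.Ico l l', (∑ j ∈ Finset.range k, (N j : ℝ)) * gap α N P k +
      (∑ k ∈ Finset.range l', (N k : ℝ)) *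
        (∑' k, 2 * gap α N P k - partialLength α N P l') := by
  set Q := ∑ k ∈ Finset.Ico l l', N k with hQ
  set s := ∑' k, 2 * gap α N P k with hs
  set θ : UnitAddCircle := (α : UnitAddCircle) with hθ
  let e : ℕ → UnitAddCircle → ZMod 2 := fun k x =>
    level α N P k (x + Q • θ) - level α N P k x -
      if l ≤ k then level α N P k (x + N k • θ) - level α N P k x else 0
  let r : UnitAddCircle → ZMod 2 := fun x =>
    ∑ i ∈ Finset.range Q, par (s - partialLength α N P l')
        (x + ((i + 1) • θ - partialLength α N P l'))
  have hsplit : (fun x => ∑ i ∈ Finset.range Q, par s (x + (i + 1) • θ) -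
      ∑ k ∈ Finset.Ico l l', (level α N P k (x + N k • θ) - level α N P k x)) =
      fun x => ∑ k ∈ Finset.range l', e k x + r x := by
    funext x
    rw [h.sum_par_tsum_eq l' Q x]
    have : ∑ k ∈ Finset.Ico l l', (level α N P k (x + N k • θ) - level α N P k x) =
        ∑ k ∈ Finset.range l',
          if l ≤ k then level α N P k (x + N k • θ) - level α N P k x else 0 := by
      rw [← Finset.sum_filter]
      refine Finset.sum_congr ?_ fun _ _ => rfl
      ext k; simp; omega
    rw [this]
    simp only [e, r, Finset.sum_sub_distrib]
    ring
  have hr : size r ≤ (∑ k ∈ Finset.range l', (N k : ℝ)) * (s - partialLength α N P l') := by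
    have h0 : 0 ≤ s - partialLength α N P l' := by linarith [h.partialLength_le l']
    have h1 : s - partialLength α N P l' ≤ 1 := by
      linarith [h.partialLength_nonneg l', h.tsum_lt]
    refine (size_sum_le _ _).trans ?_
    simp only [size_comp_add, size_par h0 h1, Finset.sum_const, Finset.card_range, nsmul_eq_mul]
    refine mul_le_mul_of_nonneg_right ?_ h0
    rw [hQ, Nat.cast_sum]
    refine Finset.sum_le_sum_of_subset_of_nonneg ?_ fun _ _ _ => Nat.cast_nonneg _
    intro k; simp
  -- The shift by `Q` is undone in two steps for each level: the return times of the higher levels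
  -- translate it by a small amount, those of the lower levels move only the ends of the tower.
  have he : ∀ k ∈ Finset.range l', size (e k) ≤
      2 * N k * ∑ j ∈ Finset.Ico (max l (k + 1)) l', gap α N P j +
        if l ≤ k then 2 * (∑ j ∈ Finset.range k, (N j : ℝ)) * gap α N P k else 0 := by
    intro k hk
    rw [Finset.mem_range] at hk
    have hsmall : gap α N P k + ∑ j ∈ Finset.Ico (max l (k + 1)) l', gap α N P j ≤ 1 := by
      linarith [h.two_mul_gap_le k, h.sum_gap_le (Finset.Ico (max l (k + 1)) l')]
    have hTnn : 0 ≤ ∑ j ∈ Finset.Ico (max l (k + 1)) l', gap α N P j :=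
      Finset.sum_nonneg fun j _ => (h.gap_pos j).le
    have htr : size (fun x => level α N P k
          (x + (∑ j ∈ Finset.Ico (max l (k + 1)) l', N j) • θ) - level α N P k x) ≤
        2 * N k * ∑ j ∈ Finset.Ico (max l (k + 1)) l', gap α N P j := by
      rw [← coe_sum_gap α N P]
      exact size_tower_translate_le _ (h.gap_pos k).le hTnn hsmall _ _
    by_cases hlk : l ≤ k
    · have hmax : max l (k + 1) = k + 1 := by omega
      rw [hmax] at htr ⊢
      have hQ' : Q = ∑ j ∈ Finset.Ico l k, N j + N k + ∑ j ∈ Finset.Ico (k + 1) l', N j := by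
        rw [hQ, ← Finset.sum_Ico_consecutive _ hlk hk.le, Finset.sum_eq_sum_Ico_succ_bot hk]
        ring
      set A := ∑ j ∈ Finset.Ico l k, N j with hA
      set B := ∑ j ∈ Finset.Ico (k + 1) l', N j with hB
      have heq : e k = fun x =>
          (fun y => level α N P k (y + A • θ) - level α N P k y) (x + (N k • θ + B • θ)) +
          (fun y => level α N P k (y + B • θ) - level α N P k y) (x + N k • θ) := by
        funext x
        simp only [e, if_pos hlk, hQ']
        have h1 : x + (A + N k + B) • θ = x + (N k • θ + B • θ) + A • θ := by
          rw [add_smul, add_smul]; abel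
        rw [h1, add_assoc x (N k • θ) (B • θ)]
        ring
      rw [heq, if_pos hlk, add_comm (2 * (N k : ℝ) * _)]
      refine (size_add_le _ _).trans ?_
      refine add_le_add
        ((size_comp_add (fun y => level α N P k (y + A • θ) - level α N P k y) _).trans_le ?_)
        ((size_comp_add (fun y => level α N P k (y + B • θ) - level α N P k y) _).trans_le htr)
      refine (size_tower_nsmul_le θ (h.gap_pos k).le
        (by linarith [h.two_mul_gap_le k, h.gap_pos k]) _ _ A).trans ?_
      have hAle : (A : ℝ) ≤ ∑ j ∈ Finset.range k, (N j : ℝ) := by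
        rw [hA, Nat.cast_sum]
        refine Finset.sum_le_sum_of_subset_of_nonneg ?_ fun _ _ _ => Nat.cast_nonneg _
        intro k; simp
      have := (h.gap_pos k).le
      gcongr
    · have hmax : max l (k + 1) = l := by omega
      rw [hmax] at htr ⊢
      rw [if_neg hlk, add_zero]
      simpa only [e, if_neg hlk, sub_zero] using htr
  rw [hsplit]
  refine (size_add_le _ _).trans (add_le_add ?_ hr)
  refine (size_sum_le _ _).trans ((Finset.sum_le_sum he).trans ?_)
  rw [Finset.sum_add_distrib]
  have h1 : ∑ k ∈ Finset.range l',
      2 * (N k : ℝ) * ∑ j ∈ Finset.Ico (max l (k + 1)) l', gap α N P j =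
      2 * ∑ j ∈ Finset.Ico l l', (∑ k ∈ Finset.range j, (N k : ℝ)) * gap α N P j := by
    simp only [Finset.mul_sum, Finset.sum_mul]
    rw [Finset.sum_comm' (t' := Finset.Ico l l') (s' := fun j => Finset.range j)]
    · refine Finset.sum_congr rfl fun j _ => Finset.sum_congr rfl fun k _ => by ring
    · intro k j
      simp only [Finset.mem_range, Finset.mem_Ico]
      omega
  have h2 : (∑ k ∈ Finset.range l',
      if l ≤ k then 2 * (∑ j ∈ Finset.range k, (N j : ℝ)) * gap α N P k else 0) =
      2 * ∑ j ∈ Finset.Ico l l', (∑ k ∈ Finset.range j, (N k : ℝ)) * gap α N P j := by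
    rw [← Finset.sum_filter, Finset.mul_sum]
    refine Finset.sum_congr ?_ fun _ _ => by ring
    ext k; simp; omega
  rw [h1, h2]
  linarith

end SparseTimes
end

/-! ### Separation of orbits and quasi-independence of visits -/

/-- Points of the circle that are pairwise `η`-separated visit an arc of length `d` at most
`⌈d / η⌉` times. -/
lemma sum_hit_le {s : Finset ℕ} {u : ℕ → ℝ} {η d : ℝ} (hη : 0 < η) (hd : d ≤ 1)
    (hsep : ∀ i ∈ s, ∀ j ∈ s, i ≠ j → ∀ z : ℤ, η ≤ |u i - u j - z|) :
    ∑ i ∈ s, hit d (u i) ≤ ⌈d / η⌉₊ := by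
  simp only [hit_coe hd]
  rw [← Finset.card_filter, ← Finset.card_range ⌈d / η⌉₊]
  refine Finset.card_le_card_of_injOn (fun i => ⌊Int.fract (u i) / η⌋₊) ?_ ?_
  · intro i hi
    simp only [Finset.coe_filter, Set.mem_ofPred_eq] at hi
    simp only [Finset.coe_range, Set.mem_Iio]
    rw [Nat.floor_lt (div_nonneg (Int.fract_nonneg _) hη.le)]
    exact (div_lt_div_of_pos_right hi.2 hη).trans_le (Nat.le_ceil _)
  · intro i hi j hj hij
    simp only [Finset.coe_filter, Set.mem_ofPred_eq] at hi hj
    by_contra hne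
    have h1 := hsep i hi.1 j hj.1 hne (⌊u i⌋ - ⌊u j⌋)
    have h2 : u i - u j - ((⌊u i⌋ - ⌊u j⌋ : ℤ) : ℝ) = Int.fract (u i) - Int.fract (u j) := by
      rw [← Int.self_sub_floor, ← Int.self_sub_floor]; push_cast; ring
    rw [h2] at h1
    have hi0 : 0 ≤ Int.fract (u i) / η := div_nonneg (Int.fract_nonneg _) hη.le
    have hj0 : 0 ≤ Int.fract (u j) / η := div_nonneg (Int.fract_nonneg _) hη.le
    have h3 := Nat.floor_le hi0
    have h4 := Nat.lt_floor_add_one (Int.fract (u i) / η)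
    have h5 := Nat.floor_le hj0
    have h6 := Nat.lt_floor_add_one (Int.fract (u j) / η)
    simp only at hij
    rw [hij] at h3 h4
    have h7 : |Int.fract (u i) / η - Int.fract (u j) / η| < 1 := by
      rw [abs_lt]; constructor <;> linarith
    rw [← sub_div, abs_div, abs_of_pos hη, div_lt_one hη] at h7
    linarith

section Separation
variable {α : ℝ} {N : ℕ} {P : ℤ}

/-- Multiples `m α` with `0 < m < 2 N` are at distance at least `N α - P` from the integers. -/
lemma gap_le_abs_mul_sub (hcop : IsCoprime P (N : ℤ)) (hpos : 0 < N * α - P)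
    (hsmall : 3 * (N * (N * α - P)) ≤ 1) {m : ℕ} (hm : 0 < m) (hmN : m < 2 * N) (z : ℤ) :
    N * α - P ≤ |m * α - z| := by
  have hN : (0 : ℝ) < N := by
    have : 0 < N := by omega
    exact_mod_cast this
  by_cases h : (m : ℤ) * P - z * N = 0
  · have hdvd : (N : ℤ) ∣ m := by
      refine hcop.symm.dvd_of_dvd_mul_right ⟨z, ?_⟩
      linarith
    obtain ⟨c, hc⟩ := Int.natCast_dvd_natCast.mp hdvd
    have hc1 : c = 1 := by
      rcases Nat.lt_or_ge c 2 with h2 | h2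
      · interval_cases c <;> simp_all
      · nlinarith
    subst hc1
    rw [mul_one] at hc
    subst hc
    have hz : z = P := by
      have : (m : ℤ) ≠ 0 := by exact_mod_cast hm.ne'
      have h2 : (m : ℤ) * (P - z) = 0 := by linarith
      rcases mul_eq_zero.mp h2 with h3 | h3
      · exact absurd h3 this
      · linarith
    rw [hz]
    exact le_abs_self _
  · have h1 : (1 : ℝ) ≤ |(m : ℝ) * P - z * N| := by
      have := Int.one_le_abs h
      exact_mod_cast this
    have h2 : (N : ℝ) * (m * α - z) = (m * P - z * N) + m * (N * α - P) := by ring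
    have hm' : (m : ℝ) ≤ 2 * N := by exact_mod_cast hmN.le
    have h3 : (N : ℝ) * |m * α - z| = |(m * P - z * N) + m * (N * α - P)| := by
      rw [← h2, abs_mul, abs_of_pos hN]
    have h4 := abs_sub_abs_le_abs_add ((m : ℝ) * P - z * N) (m * (N * α - P))
    rw [abs_of_nonneg (by positivity : 0 ≤ (m : ℝ) * (N * α - P))] at h4
    have h5 : (m : ℝ) * (N * α - P) ≤ 2 * N * (N * α - P) :=
      mul_le_mul_of_nonneg_right hm' hpos.le
    have h6 : N * (N * α - P) ≤ N * |m * α - z| := by linarith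
    exact le_of_mul_le_mul_left h6 hN

/-- Multiples `m α` with `0 < m < N` are at distance at least `1 / (2 N)` from the integers. -/
lemma half_inv_le_abs_mul_sub (hcop : IsCoprime P (N : ℤ)) (hpos : 0 < N * α - P)
    (hsmall : 2 * (N * (N * α - P)) ≤ 1) {m : ℕ} (hm : 0 < m) (hmN : m < N) (z : ℤ) :
    (2 * (N : ℝ))⁻¹ ≤ |m * α - z| := by
  have hN : (0 : ℝ) < N := by
    have : 0 < N := by omega
    exact_mod_cast this
  have h : (m : ℤ) * P - z * N ≠ 0 := by
    intro h
    have hdvd : (N : ℤ) ∣ m := by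
      refine hcop.symm.dvd_of_dvd_mul_right ⟨z, ?_⟩
      linarith
    exact absurd (Nat.le_of_dvd hm (Int.natCast_dvd_natCast.mp hdvd)) (by omega)
  have h1 : (1 : ℝ) ≤ |(m : ℝ) * P - z * N| := by
    have := Int.one_le_abs h
    exact_mod_cast this
  have h2 : (N : ℝ) * (m * α - z) = (m * P - z * N) + m * (N * α - P) := by ring
  have hm' : (m : ℝ) ≤ N := by exact_mod_cast hmN.le
  have h3 : (N : ℝ) * |m * α - z| = |(m * P - z * N) + m * (N * α - P)| := by
    rw [← h2, abs_mul, abs_of_pos hN]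
  have h4 := abs_sub_abs_le_abs_add ((m : ℝ) * P - z * N) (m * (N * α - P))
  rw [abs_of_nonneg (by positivity : 0 ≤ (m : ℝ) * (N * α - P))] at h4
  have h5 : (m : ℝ) * (N * α - P) ≤ N * (N * α - P) :=
    mul_le_mul_of_nonneg_right hm' hpos.le
  rw [inv_le_iff_one_le_mul₀ (by positivity)]
  linarith

/-- A separation bound for multiples `m α` with `0 < m < n` separates the points of every orbit
segment of length `n`. -/
lemma separated_of_forall {n : ℕ} {η : ℝ}
    (h : ∀ m : ℕ, 0 < m → m < n → ∀ z : ℤ, η ≤ |m * α - z|)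
    {i j : ℕ} (hi : i < n) (hj : j < n) (hij : i ≠ j) (z : ℤ) : η ≤ |i * α - j * α - z| := by
  rcases lt_or_gt_of_ne hij with hlt | hlt
  · have := h (j - i) (by omega) (by omega) (-z)
    rw [Nat.cast_sub hlt.le] at this
    rw [← abs_neg]
    convert this using 2
    push_cast; ring
  · have := h (i - j) (by omega) (by omega) z
    rw [Nat.cast_sub hlt.le] at this
    convert this using 2
    ring

lemma exists_coe_eq (x : UnitAddCircle) : ∃ t : ℝ, (t : UnitAddCircle) = x :=
  ⟨_, (AddCircle.equivIco (1 : ℝ) 0).symm_apply_apply x⟩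

/-- A backward orbit segment of length `2 N` visits an arc of length `N α - P` at most once. -/
lemma sum_hit_sub_le_one (hcop : IsCoprime P (N : ℤ)) (hpos : 0 < N * α - P)
    (hle : N * α - P ≤ 1) (hsmall : 3 * (N * (N * α - P)) ≤ 1) (x : UnitAddCircle) :
    ∑ i ∈ Finset.range (2 * N), hit (N * α - P) (x - i • (α : UnitAddCircle)) ≤ 1 := by
  obtain ⟨t, rfl⟩ := exists_coe_eq x
  have h1 : ∀ i : ℕ, (t : UnitAddCircle) - i • (α : UnitAddCircle) =
      ((t - i * α : ℝ) : UnitAddCircle) := by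
    intro i
    show (t : AddCircle (1 : ℝ)) - i • (α : AddCircle (1 : ℝ)) =
      ((t - i * α : ℝ) : AddCircle (1 : ℝ))
    rw [AddCircle.coe_sub, ← nsmul_eq_mul, AddCircle.coe_nsmul]
  simp only [h1]
  refine (sum_hit_le hpos hle (u := fun i : ℕ => t - i * α) ?_).trans ?_
  · intro i hi j hj hij z
    rw [Finset.mem_range] at hi hj
    have := separated_of_forall (fun m h0 h1 => gap_le_abs_mul_sub hcop hpos hsmall h0 h1)
      hj hi hij.symm z
    convert this using 2
    ring
  · rw [div_self hpos.ne']; simp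

/-- An orbit segment of length `N` is `1 / (2 N)`-separated, which bounds its visits to an arc. -/
lemma sum_range_hit_add_le (hcop : IsCoprime P (N : ℤ)) (hN : 0 < N) (hpos : 0 < N * α - P)
    (hsmall : 3 * (N * (N * α - P)) ≤ 1) {d : ℝ} (hd0 : 0 ≤ d) (hd : d ≤ 1) (x : UnitAddCircle) :
    ∑ i ∈ Finset.range N, (hit d (x + i • (α : UnitAddCircle)) : ℝ) ≤ 2 * N * d + 1 := by
  have hN' : (0 : ℝ) < N := by exact_mod_cast hN
  obtain ⟨t, rfl⟩ := exists_coe_eq x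
  have h1 : ∀ i : ℕ, (t : UnitAddCircle) + i • (α : UnitAddCircle) =
      ((t + i * α : ℝ) : UnitAddCircle) := by
    intro i
    show (t : AddCircle (1 : ℝ)) + i • (α : AddCircle (1 : ℝ)) =
      ((t + i * α : ℝ) : AddCircle (1 : ℝ))
    rw [AddCircle.coe_add, ← nsmul_eq_mul, AddCircle.coe_nsmul]
  simp only [h1]
  have h2 : ∑ i ∈ Finset.range N, hit d ((t + i * α : ℝ) : UnitAddCircle) ≤
      ⌈d / (2 * (N : ℝ))⁻¹⌉₊ := by
    refine sum_hit_le (by positivity) hd (u := fun i : ℕ => t + i * α) ?_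
    intro i hi j hj hij z
    rw [Finset.mem_range] at hi hj
    have := separated_of_forall (fun m h0 h1 => half_inv_le_abs_mul_sub hcop hpos
      (by have : 0 < N * (N * α - P) := by positivity
          linarith) h0 h1) hi hj hij z
    convert this using 2
    ring
  have h3 := (Nat.ceil_lt_add_one (show 0 ≤ d / (2 * (N : ℝ))⁻¹ by positivity)).le
  have h4 : d / (2 * (N : ℝ))⁻¹ = 2 * N * d := by rw [div_inv_eq_mul]; ring
  rw [h4] at h3 h2
  refine le_trans ?_ h3
  exact_mod_cast h2

lemma sum_range_two_mul_hit_add_le (hcop : IsCoprime P (N : ℤ)) (hN : 0 < N)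
    (hpos : 0 < N * α - P) (hsmall : 3 * (N * (N * α - P)) ≤ 1) {d : ℝ} (hd0 : 0 ≤ d)
    (hd : d ≤ 1) (x : UnitAddCircle) :
    ∑ i ∈ Finset.range (2 * N), (hit d (x + i • (α : UnitAddCircle)) : ℝ) ≤ 4 * N * d + 2 := by
  rw [two_mul, Finset.sum_range_add]
  have h1 := sum_range_hit_add_le hcop hN hpos hsmall hd0 hd x
  have h2 := sum_range_hit_add_le hcop hN hpos hsmall hd0 hd (x + N • (α : UnitAddCircle))
  simp only [add_smul, ← add_assoc] at h2 ⊢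
  linarith

end Separation

lemma integrable_of_measurable_nat {f : UnitAddCircle → ℕ} (hf : Measurable f) {B : ℕ}
    (hB : ∀ x, f x ≤ B) : Integrable (fun x => (f x : ℝ)) := by
  refine Integrable.of_bound (C := B) (measurable_from_top.comp hf).aestronglyMeasurable ?_
  filter_upwards with x
  rw [Real.norm_of_nonneg (Nat.cast_nonneg _)]
  exact_mod_cast hB x

lemma integral_hit {d : ℝ} (hd0 : 0 ≤ d) (hd : d ≤ 1) : ∫ x, (hit d x : ℝ) = d := by
  have : (fun x => (hit d x : ℝ)) = (arc d).indicator 1 := by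
    classical
    funext x
    simp only [hit, Set.indicator_apply, Pi.one_apply]; split_ifs <;> simp
  rw [this, integral_indicator_one (measurableSet_arc hd), volume_real_arc hd0 hd]

lemma integrable_hit_mul_hit {d e : ℝ} (hd : d ≤ 1) (he : e ≤ 1) (a b : UnitAddCircle) :
    Integrable (fun x => (hit d (x + a) : ℝ) * hit e (x + b)) := by
  have := integrable_of_measurable_nat (f := fun x => hit d (x + a) * hit e (x + b)) (B := 1)
    (((measurable_hit hd).comp (measurable_add_const a)).mul
      ((measurable_hit he).comp (measurable_add_const b)))
    (fun x => Nat.mul_le_mul (hit_le_one _ _) (hit_le_one _ _))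
  simpa using this

/-- The number of visits of `x` to `2 N` arcs of length `d` along a backward orbit. -/
def visits (θ : UnitAddCircle) (d : ℝ) (N : ℕ) (a x : UnitAddCircle) : ℕ :=
  ∑ i ∈ Finset.range (2 * N), hit d (x + a - i • θ)

lemma measurable_visits (θ : UnitAddCircle) {d : ℝ} (hd : d ≤ 1) (N : ℕ) (a : UnitAddCircle) :
    Measurable (visits θ d N a) := by
  unfold visits
  refine Finset.measurable_fun_sum _ fun i _ => (measurable_hit hd).comp ?_
  exact (measurable_add_const a).sub_const _

lemma integral_visits (θ : UnitAddCircle) {d : ℝ} (hd0 : 0 ≤ d) (hd : d ≤ 1) (N : ℕ)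
    (a : UnitAddCircle) : ∫ x, (visits θ d N a x : ℝ) = 2 * (N * d) := by
  simp only [visits, Nat.cast_sum, add_sub_assoc]
  rw [integral_finsetSum]
  · have : ∀ i : ℕ, ∫ x, (hit d (x + (a - i • θ)) : ℝ) = d := fun i => by
      rw [integral_add_right_eq_self (fun x => (hit d x : ℝ)), integral_hit hd0 hd]
    simp only [this, Finset.sum_const, Finset.card_range, nsmul_eq_mul]
    push_cast; ring
  · intro i _
    exact integrable_of_measurable_nat ((measurable_hit hd).comp (measurable_add_const _))
      fun x => hit_le_one _ _

/-- Quasi-independence: if `N' d ≥ 1 / 2`, the visits on two scales are correlated at most as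
much as independent events, up to a constant. -/
lemma integral_visits_mul_visits_le {α : ℝ} {N N' : ℕ} {P' : ℤ} {d : ℝ} (hd0 : 0 ≤ d) (hd : d ≤ 1)
    (hcop : IsCoprime P' (N' : ℤ)) (hN : 0 < N') (hpos : 0 < N' * α - P') (hle : N' * α - P' ≤ 1)
    (hsmall : 3 * (N' * (N' * α - P')) ≤ 1) (hbig : 1 ≤ 2 * (N' * d)) (a b : UnitAddCircle) :
    ∫ x, (visits α d N a x : ℝ) * visits α (N' * α - P') N' b x ≤
      16 * (N * d) * (N' * (N' * α - P')) := by
  set e := N' * α - P' with he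
  set θ : UnitAddCircle := (α : UnitAddCircle) with hθ
  have h1 : ∀ x, (visits θ d N a x : ℝ) * visits θ e N' b x =
      ∑ i ∈ Finset.range (2 * N), ∑ j ∈ Finset.range (2 * N'),
        (hit d (x + (a - i • θ)) : ℝ) * hit e (x + (b - j • θ)) := by
    intro x
    simp only [visits, Nat.cast_sum, Finset.sum_mul_sum, add_sub_assoc]
  simp only [h1]
  rw [integral_finsetSum _ fun i _ => integrable_finsetSum _ fun j _ =>
    integrable_hit_mul_hit hd hle _ _]
  have h2 : ∀ i ∈ Finset.range (2 * N), ∫ x, ∑ j ∈ Finset.range (2 * N'),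
      (hit d (x + (a - i • θ)) : ℝ) * hit e (x + (b - j • θ)) ≤ (4 * N' * d + 2) * e := by
    intro i _
    rw [integral_finsetSum _ fun j _ => integrable_hit_mul_hit hd hle _ _]
    have h3 : ∀ j : ℕ, ∫ x, (hit d (x + (a - i • θ)) : ℝ) * hit e (x + (b - j • θ)) =
        ∫ x, (hit d (x + (a - i • θ - b + j • θ)) : ℝ) * hit e (x + 0) := by
      intro j
      rw [← integral_add_right_eq_self (fun x => (hit d (x + (a - i • θ - b + j • θ)) : ℝ) *
        hit e (x + 0)) (b - j • θ)]
      refine integral_congr_ae (Eventually.of_forall fun x => ?_)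
      have e1 : x + (b - j • θ) + (a - i • θ - b + j • θ) = x + (a - i • θ) := by abel
      simp only [e1, add_zero]
    simp only [h3]
    -- for fixed `x` in the short arc, count the visits of an orbit segment to the long arc
    rw [← integral_finsetSum _ fun j _ => integrable_hit_mul_hit hd hle _ _]
    have hint : Integrable fun x => (hit e x : ℝ) :=
      integrable_of_measurable_nat (measurable_hit hle) (hit_le_one e)
    calc _ ≤ ∫ x, (4 * N' * d + 2) * (hit e x : ℝ) := by
          refine integral_mono (integrable_finsetSum _ fun j _ =>
            integrable_hit_mul_hit hd hle _ _) (hint.const_mul _) fun x => ?_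
          simp only [add_zero, ← add_assoc]
          rw [← Finset.sum_mul]
          refine mul_le_mul_of_nonneg_right ?_ (Nat.cast_nonneg _)
          exact sum_range_two_mul_hit_add_le hcop hN hpos hsmall hd0 hd _
      _ = _ := by rw [integral_const_mul, integral_hit hpos.le hle]
  refine (Finset.sum_le_sum h2).trans ?_
  simp only [Finset.sum_const, Finset.card_range, nsmul_eq_mul]
  push_cast
  have h5 : (4 * N' * d + 2) * e ≤ (8 * (N' * d)) * e :=
    mul_le_mul_of_nonneg_right (by linarith) hpos.le
  have h6 : (0 : ℝ) ≤ 2 * N := by positivity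
  nlinarith [mul_le_mul_of_nonneg_left h5 h6]

/-! ### Odd Birkhoff sums at good return times -/

namespace SparseTimes
variable {α : ℝ} {N : ℕ → ℕ} {P : ℕ → ℤ}

/-- The visits to the `2 N k` arcs on which the `k`-th level changes under `N k` steps. -/
def levelVisits (α : ℝ) (N : ℕ → ℕ) (P : ℕ → ℤ) (k : ℕ) : UnitAddCircle → ℕ :=
  visits α (gap α N P k) (N k) (N k • (α : UnitAddCircle) - partialLength α N P k)

lemma level_add_sub_level (α : ℝ) (N : ℕ → ℕ) (P : ℕ → ℤ) (k : ℕ) (x : UnitAddCircle) :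
    level α N P k (x + N k • (α : UnitAddCircle)) - level α N P k x =
      (levelVisits α N P k x : ZMod 2) := by
  rw [level, tower_add_nsmul_sub]
  simp [levelVisits, visits, par]

lemma gap_le_one (h : SparseTimes α N P) (k : ℕ) : gap α N P k ≤ 1 := by
  linarith [h.two_mul_gap_le k, h.gap_pos k]

lemma levelVisits_le_one (h : SparseTimes α N P) {k : ℕ} (hk : 3 * (N k * gap α N P k) ≤ 1)
    (x : UnitAddCircle) : levelVisits α N P k x ≤ 1 :=
  sum_hit_sub_le_one (h.coprime k) (h.gap_pos k) (h.gap_le_one k) hk _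

/-- A second moment bound: since `2 C - C ^ 2 ≤ 1`, with equality only for `C = 1`, a count `C`
with small mean and quasi-independent summands is odd with probability at least about its mean. -/
lemma le_size_sum_level (h : SparseTimes α N P) (K : Finset ℕ)
    (hK : ∀ k ∈ K, 3 * (N k * gap α N P k) ≤ 1)
    (hpair : ∀ k ∈ K, ∀ k' ∈ K, k < k' → 1 ≤ 2 * (N k' * gap α N P k)) :
    2 * ∑ k ∈ K, N k * gap α N P k - 16 * (∑ k ∈ K, N k * gap α N P k) ^ 2 ≤
      size (fun x => ∑ k ∈ K,
        (level α N P k (x + N k • (α : UnitAddCircle)) - level α N P k x)) := by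
  classical
  set p : ℕ → ℝ := fun k => N k * gap α N P k with hp
  set v : ℕ → UnitAddCircle → ℕ := levelVisits α N P with hv
  have hpnn : ∀ k, 0 ≤ p k := fun k => mul_nonneg (Nat.cast_nonneg _) (h.gap_pos k).le
  have hvm : ∀ k, Measurable (v k) := fun k => measurable_visits _ (h.gap_le_one k) _ _
  have hv1 : ∀ k ∈ K, ∀ x, v k x ≤ 1 := fun k hk x => h.levelVisits_le_one (hK k hk) x
  have hvint : ∀ k ∈ K, Integrable fun x => (v k x : ℝ) := fun k hk =>
    integrable_of_measurable_nat (hvm k) (hv1 k hk)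
  have hvvint : ∀ k ∈ K, ∀ k' ∈ K, Integrable fun x => (v k x : ℝ) * v k' x := by
    intro k hk k' hk'
    have := integrable_of_measurable_nat (f := fun x => v k x * v k' x) (B := 1)
      ((hvm k).mul (hvm k')) fun x => Nat.mul_le_mul (hv1 k hk x) (hv1 k' hk' x)
    simpa using this
  have hmean : ∀ k, ∫ x, (v k x : ℝ) = 2 * p k := fun k =>
    integral_visits _ (h.gap_pos k).le (h.gap_le_one k) _ _
  have hlt : ∀ k ∈ K, ∀ k' ∈ K, k < k' → ∫ x, (v k x : ℝ) * v k' x ≤ 16 * p k * p k' := by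
    intro k hk k' hk' hkk
    exact integral_visits_mul_visits_le (h.gap_pos k).le (h.gap_le_one k) (h.coprime k')
      (h.pos k') (h.gap_pos k') (h.gap_le_one k') (hK k' hk') (hpair k hk k' hk' hkk) _ _
  have hcorr : ∀ k ∈ K, ∀ k' ∈ K, ∫ x, (v k x : ℝ) * v k' x ≤
      (if k = k' then 2 * p k else 0) + 16 * p k * p k' := by
    intro k hk k' hk'
    rcases lt_trichotomy k k' with hkk | rfl | hkk
    · rw [if_neg hkk.ne, zero_add]; exact hlt k hk k' hk' hkk
    · rw [if_pos rfl]
      have h1 : ∀ x, (v k x : ℝ) * v k x = v k x := by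
        intro x
        have := hv1 k hk x
        interval_cases v k x <;> simp
      simp only [h1, hmean]
      nlinarith [mul_nonneg (hpnn k) (hpnn k)]
    · rw [if_neg hkk.ne', zero_add]
      have := hlt k' hk' k hk hkk
      simp only [mul_comm (v k _ : ℝ)]
      linarith
  set C : UnitAddCircle → ℕ := fun x => ∑ k ∈ K, v k x with hC
  have hCm : Measurable C := Finset.measurable_fun_sum _ fun k _ => hvm k
  have hsize : size (fun x => ∑ k ∈ K,
      (level α N P k (x + N k • (α : UnitAddCircle)) - level α N P k x)) =
      ∫ x, {x | (C x : ZMod 2) ≠ 0}.indicator (1 : UnitAddCircle → ℝ) x := by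
    have hm : MeasurableSet {x | (C x : ZMod 2) ≠ 0} :=
      hCm (MeasurableSet.of_discrete (s := {m : ℕ | (m : ZMod 2) ≠ 0}))
    rw [integral_indicator_one hm, size]
    simp only [level_add_sub_level, hC, Nat.cast_sum, hv]
  have hsq : ∀ x, (C x : ℝ) * C x = ∑ k ∈ K, ∑ k' ∈ K, (v k x : ℝ) * v k' x := by
    intro x
    simp only [hC, Nat.cast_sum, Finset.sum_mul_sum]
  have hCint : Integrable fun x => (C x : ℝ) := by
    simp only [hC, Nat.cast_sum]
    exact integrable_finsetSum _ hvint
  have hCCint : Integrable fun x => (C x : ℝ) * C x := by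
    simp only [hsq]
    exact integrable_finsetSum _ fun k hk => integrable_finsetSum _ fun k' hk' =>
      hvvint k hk k' hk'
  have hCmean : ∫ x, (C x : ℝ) = 2 * ∑ k ∈ K, p k := by
    simp only [hC, Nat.cast_sum]
    rw [integral_finsetSum _ hvint, Finset.mul_sum]
    simp only [hmean]
  have hCC : ∫ x, (C x : ℝ) * C x ≤ 2 * ∑ k ∈ K, p k + 16 * (∑ k ∈ K, p k) ^ 2 := by
    simp only [hsq]
    rw [integral_finsetSum _ fun k hk => integrable_finsetSum _ fun k' hk' => hvvint k hk k' hk']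
    calc _ ≤ ∑ k ∈ K, ∑ k' ∈ K, ((if k = k' then 2 * p k else 0) + 16 * p k * p k') := by
          refine Finset.sum_le_sum fun k hk => ?_
          rw [integral_finsetSum _ fun k' hk' => hvvint k hk k' hk']
          exact Finset.sum_le_sum fun k' hk' => hcorr k hk k' hk'
      _ = _ := by
          simp only [Finset.sum_add_distrib, Finset.sum_ite_eq, sq, Finset.sum_mul_sum]
          congr 1
          · rw [Finset.mul_sum]
            exact Finset.sum_congr rfl fun k hk => if_pos hk
          · simp only [Finset.mul_sum, mul_assoc]
  have hpt : ∀ x, 2 * (C x : ℝ) - C x * C x ≤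
      {x | (C x : ZMod 2) ≠ 0}.indicator (1 : UnitAddCircle → ℝ) x := by
    intro x
    by_cases h1 : C x = 1
    · rw [Set.indicator_of_mem (by simp [h1]), h1]; norm_num
    · refine le_trans ?_ (Set.indicator_nonneg (fun _ _ => zero_le_one) x)
      rcases Nat.lt_or_ge (C x) 1 with h2 | h2
      · have : C x = 0 := by omega
        simp [this]
      · have : (2 : ℝ) ≤ C x := by
          have : 2 ≤ C x := by omega
          exact_mod_cast this
        nlinarith
  have hmono := integral_mono (f := fun x => 2 * (C x : ℝ) - C x * C x)
    ((hCint.const_mul 2).sub hCCint)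
    ((integrable_const (1 : ℝ)).indicator
      (hCm (MeasurableSet.of_discrete (s := {m : ℕ | (m : ZMod 2) ≠ 0})))) hpt
  rw [hsize]
  refine le_trans ?_ hmono
  rw [integral_sub (hCint.const_mul 2) hCCint, integral_const_mul, hCmean]
  linarith

/-- There are arbitrarily good return times `Q` of the rotation for which the `Q`-th Birkhoff sum
of the skewing cocycle is odd on a set of measure bounded below. -/
lemma exists_return_time (h : SparseTimes α N P) {ε : ℝ} (hε : 0 < ε) :
    ∃ (Q : ℕ) (t : ℝ), 0 ≤ t ∧ t < ε ∧ Q • (α : UnitAddCircle) = t ∧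
      1 / 100 ≤ size (fun x => ∑ i ∈ Finset.range Q,
        par (∑' k, 2 * gap α N P k) (x + (i + 1) • (α : UnitAddCircle))) := by
  set p : ℕ → ℝ := fun k => N k * gap α N P k with hp
  have htail : Tendsto (partialLength α N P) atTop (𝓝 (∑' k, 2 * gap α N P k)) :=
    h.summable_two_mul.hasSum.tendsto_sum_nat
  have e1 := (h.tendsto_mul_gap.eventually_lt_const (show (0 : ℝ) < 1 / 48 by norm_num))
  have e2 := (h.tendsto_sum_div.eventually_lt_const (show (0 : ℝ) < 1 / 1000 by norm_num))
  have e3 := htail.eventually_const_lt (show ∑' k, 2 * gap α N P k - ε < _ by linarith)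
  obtain ⟨l, hl⟩ := eventually_atTop.mp (e1.and (e2.and e3))
  have hpl : ∀ k, l ≤ k → p k < 1 / 48 := fun k hk => (hl k hk).1
  have hMl : ∀ k, l ≤ k → (∑ j ∈ Finset.range k, (N j : ℝ)) ≤ 1 / 1000 * N k := by
    intro k hk
    have h1 := (hl k hk).2.1
    rw [div_lt_iff₀ (by exact_mod_cast h.pos k)] at h1
    exact h1.le
  -- beyond `l` the lengths of the arcs at least halve at every step
  have hhalf : ∀ k, l ≤ k → gap α N P (k + 1) ≤ gap α N P k / 2 := by
    intro k hk
    have h1 := hpl (k + 1) (by omega)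
    have h2 := h.one_le_succ_mul_gap k
    have h3 : (0 : ℝ) < N (k + 1) := by exact_mod_cast h.pos _
    refine le_of_mul_le_mul_left (a := (N (k + 1) : ℝ)) ?_ h3
    simp only [hp] at h1
    linarith
  have hgeom : ∀ k, l ≤ k → ∀ i, gap α N P (i + k) ≤ gap α N P k * (1 / 2) ^ i := by
    intro k hk i
    induction i with
    | zero => simp
    | succ i ih =>
      have := hhalf (i + k) (by omega)
      rw [show i + 1 + k = i + k + 1 by ring, pow_succ]
      linarith
  have hremainder : ∀ k, l ≤ k →
      ∑' k, 2 * gap α N P k - partialLength α N P k ≤ 4 * gap α N P k := by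
    intro k hk
    have h1 := h.summable_two_mul.sum_add_tsum_nat_add k
    have h2 : ∑' i, 2 * gap α N P (i + k) ≤ ∑' i : ℕ, 2 * (gap α N P k * (1 / 2) ^ i) := by
      refine Summable.tsum_le_tsum (fun i => by linarith [hgeom k hk i])
        ((summable_nat_add_iff k).mpr h.summable_two_mul) ?_
      exact (summable_geometric_two.mul_left _).mul_left _
    have h3 : ∑' i : ℕ, 2 * (gap α N P k * (1 / 2) ^ i) = 4 * gap α N P k := by
      rw [tsum_mul_left, tsum_mul_left, tsum_geometric_two]
      ring
    rw [h3] at h2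
    rw [partialLength]
    linarith
  have hpair : ∀ k, l ≤ k → ∀ k', k < k' → 1 ≤ 2 * (N k' * gap α N P k) := by
    intro k hk k' hkk
    obtain ⟨m, rfl⟩ : ∃ m, k' = m + 1 := ⟨k' - 1, by omega⟩
    have h1 := h.one_le_succ_mul_gap m
    have h2 : gap α N P m ≤ gap α N P k := by
      have h3 := hgeom k hk (m - k)
      rw [Nat.sub_add_cancel (by omega)] at h3
      exact h3.trans (mul_le_of_le_one_right (h.gap_pos k).le
        (pow_le_one₀ (by norm_num) (by norm_num)))
    have h4 : (0 : ℝ) ≤ N (m + 1) := Nat.cast_nonneg _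
    nlinarith [mul_le_mul_of_nonneg_left h2 h4]
  have hex : ∃ l', l ≤ l' ∧ 1 / 48 ≤ ∑ k ∈ Finset.Ico l l', p k := by
    obtain ⟨l', hl1, hl2⟩ := ((h.tendsto_sum.eventually_ge_atTop
      (∑ k ∈ Finset.range l, p k + 1 / 48)).and (eventually_ge_atTop l)).exists
    refine ⟨l', hl2, ?_⟩
    rw [Finset.sum_Ico_eq_sub _ hl2]
    simp only [hp] at hl1 ⊢
    linarith
  classical
  -- As each `p k` is below `1 / 48`, the shortest block with sum `p` at least `1 / 48` has
  -- `p` at most `1 / 24`; there `2 p - 16 p ^ 2` is at least `1 / 36`, well above the error `4 (p + 1) / 1000`.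
  set l' := Nat.find hex with hl'
  obtain ⟨hll, hge⟩ := Nat.find_spec hex
  rw [← hl'] at hll hge
  have hle : ∑ k ∈ Finset.Ico l l', p k ≤ 1 / 24 := by
    rcases Nat.eq_or_lt_of_le hll with heq | hlt
    · rw [← heq]; simp
    · obtain ⟨m, hm⟩ : ∃ m, l' = m + 1 := ⟨l' - 1, by omega⟩
      have h1 : ¬ (l ≤ m ∧ 1 / 48 ≤ ∑ k ∈ Finset.Ico l m, p k) :=
        Nat.find_min hex (by rw [← hl']; omega)
      have h2 : l ≤ m := by omega
      have h3 : ∑ k ∈ Finset.Ico l m, p k < 1 / 48 := by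
        by_contra h3
        exact h1 ⟨h2, not_lt.mp h3⟩
      rw [hm, Finset.sum_Ico_succ_top h2]
      linarith [hpl m h2]
  refine ⟨∑ k ∈ Finset.Ico l l', N k, ∑ k ∈ Finset.Ico l l', gap α N P k,
    Finset.sum_nonneg fun k _ => (h.gap_pos k).le, ?_, (coe_sum_gap α N P _).symm, ?_⟩
  · have h1 : partialLength α N P l + ∑ k ∈ Finset.Ico l l', 2 * gap α N P k =
        partialLength α N P l' := Finset.sum_range_add_sum_Ico _ hll
    have h2 := h.partialLength_le l'
    have h3 := (hl l le_rfl).2.2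
    have h4 : 0 ≤ ∑ k ∈ Finset.Ico l l', gap α N P k :=
      Finset.sum_nonneg fun k _ => (h.gap_pos k).le
    rw [← Finset.mul_sum] at h1
    linarith
  · have hmain := h.le_size_sum_level (Finset.Ico l l')
      (fun k hk => by
        have := hpl k (Finset.mem_Ico.mp hk).1
        simp only [hp] at this
        linarith)
      (fun k hk k' _ hkk => hpair k (Finset.mem_Ico.mp hk).1 k' hkk)
    have herr := h.size_birkhoff_sub_le l l'
    have herr1 : ∑ k ∈ Finset.Ico l l', (∑ j ∈ Finset.range k, (N j : ℝ)) * gap α N P k ≤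
        1 / 1000 * ∑ k ∈ Finset.Ico l l', p k := by
      rw [Finset.mul_sum]
      refine Finset.sum_le_sum fun k hk => ?_
      have := mul_le_mul_of_nonneg_right (hMl k (Finset.mem_Ico.mp hk).1) (h.gap_pos k).le
      simp only [hp]
      linarith
    have herr2 : (∑ k ∈ Finset.range l', (N k : ℝ)) *
        (∑' k, 2 * gap α N P k - partialLength α N P l') ≤ 1 / 1000 := by
      have h1 := hremainder l' hll
      have h2 := hMl l' hll
      have h3 := hpl l' hll
      simp only [hp] at h3
      have h4 : (0 : ℝ) ≤ ∑ k ∈ Finset.range l', (N k : ℝ) := by positivity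
      have h5 := mul_le_mul_of_nonneg_left h1 h4
      have h6 := mul_le_mul_of_nonneg_right h2 (h.gap_pos l').le
      linarith
    set A : UnitAddCircle → ZMod 2 := fun x =>
      ∑ i ∈ Finset.range (∑ k ∈ Finset.Ico l l', N k),
        par (∑' k, 2 * gap α N P k) (x + (i + 1) • (α : UnitAddCircle)) with hA
    set B : UnitAddCircle → ZMod 2 := fun x =>
      ∑ k ∈ Finset.Ico l l',
        (level α N P k (x + N k • (α : UnitAddCircle)) - level α N P k x) with hB
    have hBA : B = fun x => A x - (A x - B x) := by funext x; ring
    have h1 : size B ≤ size A + size (fun x => A x - B x) := by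
      conv_lhs => rw [hBA]
      exact size_sub_le A (fun x => A x - B x)
    have h2 : size (fun x => A x - B x) ≤ _ := herr
    simp only [hp] at *
    nlinarith [hge, hle]

end SparseTimes

/-! ### From return times to unique ergodicity -/

/-- Unique ergodicity of the rotation: a measure invariant under a dense subgroup of the circle is
translation invariant, because integrals of continuous functions depend continuously on
translations. -/
lemma eq_volume_of_measurePreserving {θ : UnitAddCircle} (hθ : DenseRange fun z : ℤ => z • θ)
    (π : Measure UnitAddCircle) [IsProbabilityMeasure π] (hπ : MeasurePreserving (· + θ) π π) :
    π = volume := by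
  have hnat : ∀ m : ℕ, MeasurePreserving (· + m • θ) π π := by
    intro m
    have := hπ.iterate m
    rwa [add_right_iterate] at this
  have hinv : ∀ g : UnitAddCircle, Measure.map (g + ·) π = π := by
    intro g
    have : IsProbabilityMeasure (Measure.map (g + ·) π) :=
      Measure.isProbabilityMeasure_map (measurable_const_add g).aemeasurable
    refine ext_of_forall_integral_eq_of_IsFiniteMeasure fun f => ?_
    rw [integral_map (measurable_const_add g).aemeasurable
      f.continuous.aestronglyMeasurable]
    have hnat' : ∀ (m : ℕ) (y : UnitAddCircle), ∫ x, f (x + y + m • θ) ∂π = ∫ x, f (x + y) ∂π := by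
      intro m y
      have h1 := (hnat m).integral_comp (measurableEmbedding_addRight (m • θ)) (fun x => f (x + y))
      rw [← h1]
      simp only [add_right_comm]
    have hcont : Continuous fun g : UnitAddCircle => ∫ x, f (g + x) ∂π := by
      have := continuous_parametric_integral_of_continuous (μ := π) (s := Set.univ)
        (f := fun g x : UnitAddCircle => f (g + x))
        (f.continuous.comp continuous_add) isCompact_univ
      simpa using this
    have heq : (fun g : UnitAddCircle => ∫ x, f (g + x) ∂π) = fun _ => ∫ x, f x ∂π := by
      refine hθ.equalizer hcont continuous_const ?_
      funext z
      simp only [Function.comp_apply]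
      rcases Int.eq_nat_or_neg z with ⟨m, rfl | rfl⟩
      · have := hnat' m 0
        simpa [add_comm] using this
      · have := hnat' m (-(m • θ))
        simp only [neg_add_cancel_right] at this
        simp [this, add_comm]
    exact congrFun heq g
  have : π.IsAddLeftInvariant := ⟨hinv⟩
  have : π.IsAddHaarMeasure :=
    Measure.isAddHaarMeasure_of_isCompact_nonempty_interior π Set.univ isCompact_univ
      (by simp) (by simp) (by simp)
  have : IsProbabilityMeasure (volume : Measure UnitAddCircle) := ⟨UnitAddCircle.measure_univ⟩
  exact Measure.isAddHaarMeasure_eq_of_isProbabilityMeasure _ _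

lemma denseRange_zsmul_coe {α : ℝ} (hα : Irrational α) :
    DenseRange fun z : ℤ => z • (α : UnitAddCircle) := by
  have := (AddCircle.denseRange_zsmul_coe_iff (a := α) (p := 1)).mpr (by simpa using hα)
  exact this

/-- Continuity of translations in `L¹`. -/
lemma tendsto_integral_abs_translate_sub {w : UnitAddCircle → ℝ} (hw : Integrable w) :
    Tendsto (fun t : ℝ => ∫ x, |w (x + t) - w x|) (𝓝 0) (𝓝 0) := by
  have : Fact ((1 : ENNReal) ≠ ⊤) := ⟨ENNReal.one_ne_top⟩
  have hw1 : MemLp w 1 volume := memLp_one_iff_integrable.mpr hw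
  let W : Lp ℝ 1 (volume : Measure UnitAddCircle) := hw1.toLp w
  have hcont : Continuous fun t : ℝ => ‖(DomAddAct.mk (t : UnitAddCircle) +ᵥ W) - W‖ := by
    have hmk : Continuous fun t : ℝ => (DomAddAct.mk (t : UnitAddCircle) : UnitAddCircleᵈᵃᵃ) :=
      DomAddAct.continuous_mk.comp (AddCircle.continuous_mk' (1 : ℝ))
    exact ((hmk.vadd continuous_const).sub continuous_const).norm
  have heq : ∀ t : ℝ, ‖(DomAddAct.mk (t : UnitAddCircle) +ᵥ W) - W‖ = ∫ x, |w (x + t) - w x| := by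
    intro t
    rw [L1.norm_eq_integral_norm]
    refine integral_congr_ae ?_
    have h1 : (DomAddAct.mk (t : UnitAddCircle) +ᵥ W :
        Lp ℝ 1 (volume : Measure UnitAddCircle)) =ᵐ[volume]
        fun x => w (x + t) := by
      show ((DomAddAct.mk (t : UnitAddCircle) +ᵥ hw1.toLp w :
        Lp ℝ 1 (volume : Measure UnitAddCircle)) : UnitAddCircle → ℝ) =ᵐ[volume] _
      rw [DomAddAct.mk_vadd_toLp]
      filter_upwards [MemLp.coeFn_toLp (hw1.comp_measurePreserving
        (measurePreserving_vadd (t : UnitAddCircle) volume))] with x hx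
      refine hx.trans ?_
      simp [add_comm]
    filter_upwards [Lp.coeFn_sub (DomAddAct.mk (t : UnitAddCircle) +ᵥ W) W, h1, hw1.coeFn_toLp]
      with x h2 h3 h4
    refine (congrArg norm h2).trans ?_
    rw [Pi.sub_apply, h3, h4, Real.norm_eq_abs]
  have h := hcont.tendsto 0
  simp only [heq] at h
  simpa using h

section Skew
variable {α s : ℝ}

/-- The `Q`-th Birkhoff sum of the skewing cocycle. -/
def cocycle (α s : ℝ) (Q : ℕ) (x : UnitAddCircle) : ZMod 2 :=
  ∑ i ∈ Finset.range Q, par s (x + (i + 1) • (α : UnitAddCircle))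

lemma measurable_par (hs : s ≤ 1) : Measurable (par s) :=
  measurable_from_top.comp (measurable_hit hs)

lemma measurable_cocycle (hs : s ≤ 1) (Q : ℕ) : Measurable (cocycle α s Q) :=
  Finset.measurable_fun_sum _ fun _ _ => (measurable_par hs).comp (measurable_add_const _)

lemma skewOver_eq (α s : ℝ) (p : UnitAddCircle × ZMod 2) :
    skewOver α s p = (p.1 + α, p.2 + par s (p.1 + α)) := by
  rw [par_eq_indicator]; rfl

lemma skewOver_iterate (Q : ℕ) (p : UnitAddCircle × ZMod 2) :
    (skewOver α s)^[Q] p = (p.1 + Q • (α : UnitAddCircle), p.2 + cocycle α s Q p.1) := by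
  induction Q with
  | zero => simp [cocycle]
  | succ Q ih =>
    rw [Function.iterate_succ_apply', ih, skewOver_eq]
    have h1 : p.1 + Q • (α : UnitAddCircle) + α = p.1 + (Q + 1) • (α : UnitAddCircle) := by
      rw [add_smul, one_smul, add_assoc]
    simp only [h1, cocycle, Finset.sum_range_succ, add_assoc]

/-- The product of Lebesgue measure with the uniform measure on `ℤ / 2` is invariant. -/
lemma exists_invariant_measure (α : ℝ) (hs : s ≤ 1) :
    ∃ μ : Measure (UnitAddCircle × ZMod 2),
      IsProbabilityMeasure μ ∧ MeasurePreserving (skewOver α s) μ μ := by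
  let ν : Measure (ZMod 2) := (2⁻¹ : ENNReal) • Measure.count
  have hν : IsProbabilityMeasure ν := ⟨by
    simp only [ν, Measure.smul_apply, smul_eq_mul]
    rw [Measure.count_univ]
    simp [ENNReal.inv_mul_cancel]⟩
  have : IsProbabilityMeasure (volume : Measure UnitAddCircle) := ⟨UnitAddCircle.measure_univ⟩
  refine ⟨(volume : Measure UnitAddCircle).prod ν, inferInstance, ?_⟩
  have h := MeasurePreserving.skew_product (μc := ν) (μd := ν)
    (measurePreserving_add_right (volume : Measure UnitAddCircle) α)
    (g := fun x j => j + par s (x + α)) ?_ ?_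
  · rw [funext (skewOver_eq α s)]
    exact h
  · exact (Measurable.of_discrete (f := fun q : ZMod 2 × ZMod 2 => q.1 + q.2)).comp
      (measurable_snd.prodMk
        ((measurable_par hs).comp ((measurable_add_const _).comp measurable_fst)))
  · refine Eventually.of_forall fun x => ?_
    simp only [ν, Measure.map_smul]
    congr 1
    exact map_add_right_eq_self _ _

end Skew

/-- The nontrivial character of `ℤ / 2`, with real values. -/
def sign (j : ZMod 2) : ℝ := if j = 0 then 1 else -1

lemma zmod_two_eq_zero_or_one : ∀ a : ZMod 2, a = 0 ∨ a = 1 := by decide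

lemma map_fst_eq_volume {α s : ℝ} (hα : Irrational α)
    {μ : Measure (UnitAddCircle × ZMod 2)} [IsProbabilityMeasure μ]
    (hμ : MeasurePreserving (skewOver α s) μ μ) : μ.map Prod.fst = volume := by
  have : IsProbabilityMeasure (μ.map Prod.fst) :=
    Measure.isProbabilityMeasure_map measurable_fst.aemeasurable
  refine eq_volume_of_measurePreserving (denseRange_zsmul_coe hα) _
    ⟨measurable_add_const _, ?_⟩
  rw [Measure.map_map (measurable_add_const _) measurable_fst]
  conv_rhs => rw [← hμ.map_eq]
  rw [Measure.map_map measurable_fst hμ.measurable]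
  rfl

lemma disjoint_prod_singleton (A B : Set UnitAddCircle) :
    Disjoint (A ×ˢ ({0} : Set (ZMod 2))) (B ×ˢ {1}) := by
  rw [Set.disjoint_left]
  rintro ⟨x, i⟩ ⟨-, h1⟩ ⟨-, h2⟩
  simp only [Set.mem_singleton_iff] at h1 h2
  rw [h1] at h2
  exact absurd h2 (by decide)

lemma measureReal_prod_zero_add_one {μ : Measure (UnitAddCircle × ZMod 2)}
    [IsProbabilityMeasure μ] (hproj : μ.map Prod.fst = volume) {B : Set UnitAddCircle}
    (hB : MeasurableSet B) : μ.real (B ×ˢ {0}) + μ.real (B ×ˢ {1}) = volume.real B := by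
  rw [← measureReal_union (disjoint_prod_singleton _ _) (hB.prod (measurableSet_singleton _)),
    ← hproj, measureReal_def, measureReal_def, Measure.map_apply measurable_fst hB]
  congr 2
  ext ⟨x, i⟩
  rcases zmod_two_eq_zero_or_one i with rfl | rfl <;> simp

/-- A measure with absolutely continuous projection has a density for the difference of its
restrictions to the two copies of the circle. -/
lemma exists_fibre_density {μ : Measure (UnitAddCircle × ZMod 2)}
    [IsProbabilityMeasure μ] (hproj : μ.map Prod.fst = volume) :
    ∃ w : UnitAddCircle → ℝ, Measurable w ∧ Integrable w ∧ ∀ B, MeasurableSet B →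
      ∫ x in B, w x = μ.real (B ×ˢ {0}) - μ.real (B ×ˢ {1}) := by
  let ν : ZMod 2 → Measure UnitAddCircle := fun j => (μ.restrict (Set.univ ×ˢ {j})).map Prod.fst
  have hνreal : ∀ j {B : Set UnitAddCircle}, MeasurableSet B →
      (ν j).real B = μ.real (B ×ˢ {j}) := by
    intro j B hB
    simp only [ν]
    rw [measureReal_def, measureReal_def, Measure.map_apply measurable_fst hB,
      Measure.restrict_apply (measurable_fst hB)]
    congr 2
    ext ⟨x, i⟩; simp
  have hνac : ∀ j, ν j ≪ volume := by
    intro j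
    rw [← hproj]
    exact (Measure.absolutelyContinuous_of_le Measure.restrict_le_self).map measurable_fst
  have hνfin : ∀ j, IsFiniteMeasure (ν j) := fun j => Measure.isFiniteMeasure_map _ _
  have hint : ∀ j, Integrable fun x => ((ν j).rnDeriv volume x).toReal :=
    fun j => Measure.integrable_toReal_rnDeriv
  refine ⟨fun x => ((ν 0).rnDeriv volume x).toReal - ((ν 1).rnDeriv volume x).toReal,
    (Measure.measurable_rnDeriv _ _).ennreal_toReal.sub
      (Measure.measurable_rnDeriv _ _).ennreal_toReal, (hint 0).sub (hint 1), fun B hB => ?_⟩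
  rw [integral_sub (hint 0).integrableOn (hint 1).integrableOn,
    Measure.setIntegral_toReal_rnDeriv (hνac 0), Measure.setIntegral_toReal_rnDeriv (hνac 1),
    hνreal 0 hB, hνreal 1 hB]

lemma abs_sign (i : ZMod 2) : |sign i| = 1 := by
  unfold sign; split_ifs <;> simp

/-- The density of the difference of the two fibre measures of an invariant measure is an
eigenfunction of the cocycle. -/
lemma fibre_density_equivariant {α s : ℝ} (hs : s ≤ 1)
    {μ : Measure (UnitAddCircle × ZMod 2)} [IsProbabilityMeasure μ]
    (hμ : MeasurePreserving (skewOver α s) μ μ) {w : UnitAddCircle → ℝ} (hwint : Integrable w)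
    (hwset : ∀ B, MeasurableSet B → ∫ x in B, w x = μ.real (B ×ˢ {0}) - μ.real (B ×ˢ {1}))
    (Q : ℕ) : ∀ᵐ x, w (x + Q • (α : UnitAddCircle)) = sign (cocycle α s Q x) * w x := by
  set θ : UnitAddCircle := (α : UnitAddCircle) with hθ
  have hR := measurePreserving_add_right (volume : Measure UnitAddCircle) (Q • θ)
  have hcm := measurable_cocycle (α := α) hs Q
  have hsignm : Measurable fun x => sign (cocycle α s Q x) :=
    (Measurable.of_discrete (f := sign)).comp hcm
  have hint2 : Integrable fun x => sign (cocycle α s Q x) * w x :=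
    hwint.bdd_mul hsignm.aestronglyMeasurable (c := 1)
      (Eventually.of_forall fun x => (abs_sign _).le)
  refine Integrable.ae_eq_of_forall_setIntegral_eq _ _ (hR.integrable_comp_of_integrable hwint)
    hint2 fun B hB _ => ?_
  set B' : Set UnitAddCircle := (· - Q • θ) ⁻¹' B with hB'
  have hB'm : MeasurableSet B' := (measurable_sub_const _) hB
  have hpre : (· + Q • θ) ⁻¹' B' = B := by ext x; simp [hB']
  have hlhs : ∫ x in B, w (x + Q • θ) = ∫ x in B', w x := by
    rw [← hR.setIntegral_preimage_emb (measurableEmbedding_addRight _) w B', hpre]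
  set O : Set UnitAddCircle := {x | cocycle α s Q x = 0} with hO
  have hOm : MeasurableSet O := hcm (measurableSet_singleton 0)
  have h11 : (1 : ZMod 2) + 1 = 0 := by decide
  -- the preimage of `B' × {i}` under the `Q`-th iterate, split by the value of the cocycle
  have hiter : ∀ i : ZMod 2, μ.real (B' ×ˢ {i}) =
      μ.real ((B ∩ O) ×ˢ {i}) + μ.real ((B \ O) ×ˢ {i + 1}) := by
    intro i
    have hm : MeasurableSet (B' ×ˢ ({i} : Set (ZMod 2))) := hB'm.prod (measurableSet_singleton _)
    rw [← (hμ.iterate Q).measureReal_preimage hm.nullMeasurableSet,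
      ← measureReal_union ?_ ((hB.diff hOm).prod (measurableSet_singleton _))]
    · congr 1
      ext ⟨x, j⟩
      simp only [Set.mem_preimage, skewOver_iterate, Set.mem_prod, hB', ← hθ, add_sub_cancel_right,
        Set.mem_singleton_iff, Set.mem_union, Set.mem_inter_iff, Set.mem_sdiff, hO,
        Set.mem_ofPred_eq]
      rcases zmod_two_eq_zero_or_one (cocycle α s Q x) with h | h
      · simp [h]
      · have : j + 1 = i ↔ j = i + 1 := by
          constructor
          · rintro rfl; rw [add_assoc, h11, add_zero]
          · rintro rfl; rw [add_assoc, h11, add_zero]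
        simp [h, this]
    · rw [Set.disjoint_left]
      rintro ⟨x, j⟩ ⟨⟨-, h1⟩, -⟩ ⟨⟨-, h2⟩, -⟩
      exact h2 h1
  have hd0 := hiter 0
  have hd1 := hiter 1
  rw [zero_add] at hd0
  rw [h11] at hd1
  have hrhs : ∫ x in B, sign (cocycle α s Q x) * w x =
      (∫ x in B ∩ O, w x) - ∫ x in B \ O, w x := by
    rw [← integral_inter_add_sdiff hOm hint2.integrableOn, sub_eq_add_neg, ← integral_neg]
    congr 1
    · refine setIntegral_congr_fun (hB.inter hOm) fun x hx => ?_
      have : cocycle α s Q x = 0 := hx.2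
      simp [this, sign]
    · refine setIntegral_congr_fun (hB.diff hOm) fun x hx => ?_
      have : cocycle α s Q x ≠ 0 := hx.2
      simp [this, sign]
  rw [hlhs, hwset _ hB'm, hrhs, hwset _ (hB.inter hOm), hwset _ (hB.diff hOm), hd0, hd1]
  ring

/-- An integrable eigenfunction of the cocycle vanishes if there are return times of the rotation,
converging to `0` on the circle, at which the Birkhoff sum of the cocycle is odd with probability
bounded below: its modulus is constant by ergodicity, and translations are continuous in `L¹`. -/
lemma ae_eq_zero_of_return_times {α s : ℝ} (hα : Irrational α) (hs : s ≤ 1) {c : ℝ} (hc : 0 < c)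
    (hret : ∀ ε > 0, ∃ (Q : ℕ) (t : ℝ), 0 ≤ t ∧ t < ε ∧ Q • (α : UnitAddCircle) = t ∧
      c ≤ size (cocycle α s Q))
    {w : UnitAddCircle → ℝ} (hwm : Measurable w) (hwint : Integrable w)
    (hequiv : ∀ Q : ℕ, ∀ᵐ x, w (x + Q • (α : UnitAddCircle)) = sign (cocycle α s Q x) * w x) :
    w =ᵐ[volume] 0 := by
  have : IsProbabilityMeasure (volume : Measure UnitAddCircle) := ⟨UnitAddCircle.measure_univ⟩
  set θ : UnitAddCircle := (α : UnitAddCircle) with hθ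
  obtain ⟨b, hb⟩ : ∃ b, (fun x => |w x|) =ᵐ[volume] Function.const _ b := by
    have herg : Ergodic (· + θ) (volume : Measure UnitAddCircle) := by
      have h1 := (ergodic_add_left_iff_denseRange_zsmul (volume : Measure UnitAddCircle)).mpr
        (denseRange_zsmul_coe hα)
      have h2 : (fun x : UnitAddCircle => x + θ) = (fun x => θ + x) := funext fun x => add_comm _ _
      rw [h2]
      exact h1
    refine herg.ae_eq_const_of_ae_eq_comp_ae (hwm.abs.aestronglyMeasurable) ?_
    filter_upwards [hequiv 1] with x hx
    simp only [Function.comp_apply]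
    rw [one_smul] at hx
    rw [hx, abs_mul, abs_sign, one_mul]
  have hb0 : 0 ≤ b := by
    obtain ⟨x, hx⟩ := hb.exists
    rw [Function.const_apply] at hx
    rw [← hx]; exact abs_nonneg _
  have hbzero : b = 0 := by
    by_contra hne
    have hbpos : 0 < b := lt_of_le_of_ne hb0 (Ne.symm hne)
    have htend := tendsto_integral_abs_translate_sub hwint
    have hev := htend.eventually_lt_const (show (0 : ℝ) < 2 * b * c by positivity)
    obtain ⟨ε, hε, hball⟩ := Metric.eventually_nhds_iff.mp hev
    obtain ⟨Q, t, ht0, htε, hQt, hsz⟩ := hret ε hε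
    have hlt := hball (show dist t 0 < ε by rwa [Real.dist_eq, sub_zero, abs_of_nonneg ht0])
    rw [← hQt] at hlt
    have hOm : MeasurableSet {x | cocycle α s Q x ≠ 0} :=
      measurable_cocycle hs Q (measurableSet_singleton 0).compl
    have hval : ∫ x, |w (x + Q • θ) - w x| =
        ∫ x, {x | cocycle α s Q x ≠ 0}.indicator (fun _ => 2 * b) x := by
      refine integral_congr_ae ?_
      filter_upwards [hequiv Q, hb] with x h1 h2
      rw [Function.const_apply] at h2
      simp only [h1]
      by_cases h3 : cocycle α s Q x = 0
      · rw [Set.indicator_of_notMem (by simpa using h3)]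
        simp [h3, sign]
      · rw [Set.indicator_of_mem (by simpa using h3), ← h2]
        simp only [sign, if_neg h3]
        rw [show -1 * w x - w x = -(2 * w x) by ring, abs_neg, abs_mul]
        norm_num
    rw [hval, integral_indicator_const _ hOm, smul_eq_mul] at hlt
    have : c * (2 * b) ≤ volume.real {x | cocycle α s Q x ≠ 0} * (2 * b) :=
      mul_le_mul_of_nonneg_right hsz (by positivity)
    linarith
  filter_upwards [hb] with x hx
  rw [Function.const_apply, hbzero] at hx
  exact abs_eq_zero.mp hx

/-- Under the hypothesis of `ae_eq_zero_of_return_times`, every invariant probability measure gives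
both copies of a subset of the circle the same mass. -/
lemma measureReal_prod_singleton_eq {α s : ℝ} (hα : Irrational α) (hs : s ≤ 1) {c : ℝ} (hc : 0 < c)
    (hret : ∀ ε > 0, ∃ (Q : ℕ) (t : ℝ), 0 ≤ t ∧ t < ε ∧ Q • (α : UnitAddCircle) = t ∧
      c ≤ size (cocycle α s Q))
    (μ : Measure (UnitAddCircle × ZMod 2)) [IsProbabilityMeasure μ]
    (hμ : MeasurePreserving (skewOver α s) μ μ) {A : Set UnitAddCircle} (hA : MeasurableSet A)
    (j : ZMod 2) : μ.real (A ×ˢ {j}) = volume.real A / 2 := by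
  have hproj := map_fst_eq_volume hα hμ
  obtain ⟨w, hwm, hwint, hwset⟩ := exists_fibre_density hproj
  have hzero := ae_eq_zero_of_return_times hα hs hc hret hwm hwint
    (fibre_density_equivariant hs hμ hwint hwset)
  have hdiff := hwset A hA
  rw [integral_congr_ae (ae_restrict_of_ae hzero)] at hdiff
  simp only [Pi.zero_apply, integral_zero] at hdiff
  have hsum := measureReal_prod_zero_add_one hproj hA
  rcases zmod_two_eq_zero_or_one j with rfl | rfl <;> linarith

lemma uniquelyErgodic_of_return_times {α s : ℝ} (hα : Irrational α) (hs : s ≤ 1) {c : ℝ}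
    (hc : 0 < c)
    (hret : ∀ ε > 0, ∃ (Q : ℕ) (t : ℝ), 0 ≤ t ∧ t < ε ∧ Q • (α : UnitAddCircle) = t ∧
      c ≤ size (cocycle α s Q)) : UniquelyErgodic (skewOver α s) := by
  obtain ⟨μ₀, hprob, hpres⟩ := exists_invariant_measure α hs
  refine ⟨μ₀, ⟨hprob, hpres⟩, ?_⟩
  rintro μ ⟨hμprob, hμ⟩
  ext S hS
  have hslice : ∀ j : ZMod 2, MeasurableSet {x : UnitAddCircle | (x, j) ∈ S} := fun j =>
    measurable_prodMk_right hS
  have hsplit : S = ({x | (x, (0 : ZMod 2)) ∈ S} ×ˢ {0}) ∪ ({x | (x, (1 : ZMod 2)) ∈ S} ×ˢ {1}) := by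
    ext ⟨x, i⟩
    rcases zmod_two_eq_zero_or_one i with rfl | rfl <;> simp
  have hdisj := disjoint_prod_singleton {x | (x, (0 : ZMod 2)) ∈ S} {x | (x, (1 : ZMod 2)) ∈ S}
  rw [← measureReal_eq_measureReal_iff, hsplit,
    measureReal_union hdisj ((hslice 1).prod (measurableSet_singleton _)),
    measureReal_union hdisj ((hslice 1).prod (measurableSet_singleton _)),
    measureReal_prod_singleton_eq hα hs hc hret μ hμ (hslice 0) 0,
    measureReal_prod_singleton_eq hα hs hc hret μ hμ (hslice 1) 1,
    measureReal_prod_singleton_eq hα hs hc hret μ₀ hpres (hslice 0) 0,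
    measureReal_prod_singleton_eq hα hs hc hret μ₀ hpres (hslice 1) 1]

end SkewRotation

end


theorem proposition7p1 (α : ℝ) (n : ℕ → ℕ) (h : SkewRotation.Admissible α n) :
    SkewRotation.UniquelyErgodic (SkewRotation.skewProduct α n) := by
  obtain ⟨N, P, hNP, hlen⟩ := h.exists_sparseTimes
  rw [SkewRotation.skewProduct, hlen]
  exact SkewRotation.uniquelyErgodic_of_return_times h.alpha_irrational hNP.tsum_lt.le
    (by norm_num : (0 : ℝ) < 1 / 100) fun ε hε => hNP.exists_return_time hε
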